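/- Write $\{\pm1\}$ for the set of truth values. A literal over $x_1,\dots,x_n$ is $x_j$ or $-x_j$ for some $j$; for a $k$-tuple $C=(\sigma_1x_{j_1},\dots,\sigma_kx_{j_k})$ of literals and $x\in\{\pm1\}^n$ put $C(x)=(\sigma_1x_{j_1},\dots,\sigma_kx_{j_k})\in\{\pm1\}^k$. A probability distribution $\mu$ on $\{\pm1\}^k$ is pairwise independent if for all $i\ne j$ the marginal $(\mu_i,\mu_j)$ is uniform on $\{\pm1\}^2$ (and each $\mu_i$ is uniform on $\{\pm1\}$, which is automatic for $k\ge2$). A degree-$d$ pseudo-expectation operator is a linear functional $\tilde{\mathbb E}$ on the space of real polynomials in $x_1,\dots,x_n$ of degree at most $d$ such that $\tilde{\mathbb E}[1]=1$ and $\tilde{\mathbb E}[p^2]\ge0$ whenever $\deg p\le d/2$. It satisfies the constraint $\{p=0\}$ if $\tilde{\mathbb E}[pq]=0$ for all $q$ with $\deg q\le d-\deg p$. For a predicate $P:\{\pm1\}^k\to\{0,1\}$ and a non-empty finite set $\mathcal I$ of $k$-tuples of literals, each on $k$ distinct variables, the value of the degree-$d$ Max-$P$ SOS relaxation on $\mathcal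 I$ is the maximum of $\tilde{\mathbb E}\big[\frac1{|\mathcal I|}\sum_{C\in\mathcal I}P(C(x))\big]$ over all degree-$d$ pseudo-expectation operators $\tilde{\mathbb E}$ that satisfy the constraints $\{x_j^2-1=0\}$, $j=1,\dots,n$; here $P(C(x))$ stands for the multilinear polynomial in $x$ that takes these values on $\{\pm1\}^n$. **Theorem.** Let $k\in\mathbb N$ and $P:\{\pm1\}^k\to\{0,1\}$, and suppose that there is a pairwise independent distribution on $\{\pm1\}^k$ supported on $P^{-1}(1)$. Then for every $\varepsilon>0$ there is $\delta>0$ such that for all sufficiently large $n$ there is a non-empty set $\mathcal I$ of $k$-tuples of literals over $x_1,\dots,x_n$, each on $k$ distinct variables, such that 1. for every $x\in\{\pm1\}^n$, $\ \frac1{|\mathcal I|}\sum_{C\in\mathcal I}P(C(x))\le\frac{|P^{-1}(1)|}{2^k}+\varepsilon$; and 2. the value of the degree-$\lfloor\delta n\rfloor$ Max-$P$ SOS relaxation on $\mathcal I$ is $1$. -/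

import Mathlib

/-- A literal over the variables `x_1, …, x_n` with values in `{±1} = ℤˣ`: the pair `(j, σ)` is the
literal `σ * x_j`, that is `x_j` or `-x_j`. -/
abbrev Literal (n : ℕ) : Type := Fin n × ℤˣ

/-- A `k`-tuple of literals over `n` variables. -/
abbrev Clause (k n : ℕ) : Type := Fin k → Literal n

/-- The tuple `C(x) ∈ {±1}^k` of values of the literals of `C` at the assignment `x`. -/
def Clause.apply {k n : ℕ} (C : Clause k n) (x : Fin n → ℤˣ) : Fin k → ℤˣ :=
  fun i => (C i).2 * x (C i).1

/-- The literals of the tuple are on pairwise distinct variables. -/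
def Clause.DistinctVars {k n : ℕ} (C : Clause k n) : Prop :=
  Function.Injective fun i => (C i).1

/-- The `{0, 1}`-valued predicate `P`, as a real-valued function. -/
def predValue {k : ℕ} (P : (Fin k → ℤˣ) → Bool) (y : Fin k → ℤˣ) : ℝ :=
  if P y = true then 1 else 0

/-- The fraction of the constraints of the Max-`P` instance `I` that the assignment `x` satisfies
(meaningful for non-empty `I`). -/
noncomputable def satFraction {k n : ℕ} (P : (Fin k → ℤˣ) → Bool) (I : Finset (Clause k n))
    (x : Fin n → ℤˣ) : ℝ :=
  (∑ C ∈ I, predValue P (C.apply x)) / (I.card : ℝ)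

/-- A pairwise independent distribution on `{±1}^k`: any two coordinates are jointly uniform on
`{±1}²`. Uniformity of the single coordinates follows from this for `k ≥ 2`; it is listed so that
the notion is the standard one also for `k = 1`. -/
structure IsPairwiseIndependent {k : ℕ} (μ : PMF (Fin k → ℤˣ)) : Prop where
  single : ∀ i : Fin k, μ.map (fun y => y i) = PMF.uniformOfFintype ℤˣ
  pair : ∀ i j : Fin k, i ≠ j →
    μ.map (fun y => (y i, y j)) = PMF.uniformOfFintype (ℤˣ × ℤˣ)

/-- The space of real polynomials in `n` variables of total degree at most `d`. -/
noncomputable abbrev polyLE (n d : ℕ) : Submodule ℝ (MvPolynomial (Fin n) ℝ) :=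
  MvPolynomial.restrictTotalDegree (Fin n) ℝ d

theorem one_mem_polyLE (n d : ℕ) : (1 : MvPolynomial (Fin n) ℝ) ∈ polyLE n d := by
  simp [MvPolynomial.mem_restrictTotalDegree]

theorem mul_mem_polyLE {n d : ℕ} {p q : MvPolynomial (Fin n) ℝ}
    (h : p.totalDegree + q.totalDegree ≤ d) : p * q ∈ polyLE n d :=
  (MvPolynomial.mem_restrictTotalDegree _ _ _).2 ((MvPolynomial.totalDegree_mul p q).trans h)

theorem sq_mem_polyLE {n d : ℕ} {p : MvPolynomial (Fin n) ℝ}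
    (h : 2 * p.totalDegree ≤ d) : p ^ 2 ∈ polyLE n d :=
  (MvPolynomial.mem_restrictTotalDegree _ _ _).2 ((MvPolynomial.totalDegree_pow p 2).trans h)

/-- A degree-`d` pseudo-expectation operator: a linear functional on the polynomials of degree at
most `d` that maps `1` to `1` and is nonnegative on the squares of the polynomials of degree at most
`d / 2`. -/
structure IsPseudoExpectation {n d : ℕ} (E : polyLE n d →ₗ[ℝ] ℝ) : Prop where
  normalization : E ⟨1, one_mem_polyLE n d⟩ = 1
  positivity : ∀ (p : MvPolynomial (Fin n) ℝ) (h : 2 * p.totalDegree ≤ d),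
    0 ≤ E ⟨p ^ 2, sq_mem_polyLE h⟩

/-- `E` satisfies the constraint `{p = 0}`: `E[p q] = 0` for every `q` of degree at most
`d - deg p`. -/
def SatisfiesConstraint {n d : ℕ} (E : polyLE n d →ₗ[ℝ] ℝ) (p : MvPolynomial (Fin n) ℝ) : Prop :=
  ∀ (q : MvPolynomial (Fin n) ℝ) (h : p.totalDegree + q.totalDegree ≤ d),
    E ⟨p * q, mul_mem_polyLE h⟩ = 0

open MvPolynomial in
/-- The polynomial `∑_y f(y) ∏_i (1 + y_i σ_i x_{j_i}) / 2`, where `C = (σ_i x_{j_i})_i`. It takes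
the value `f(C(x))` at every `x ∈ {±1}^n`, and it is multilinear if the literals of `C` are on
distinct variables. -/
noncomputable def clausePoly {k n : ℕ} (f : (Fin k → ℤˣ) → ℝ) (C : Clause k n) :
    MvPolynomial (Fin n) ℝ :=
  ∑ y : Fin k → ℤˣ, MvPolynomial.C (f y) *
    ∏ i : Fin k, MvPolynomial.C (1 / 2 : ℝ) *
      (1 + MvPolynomial.C (((y i * (C i).2 : ℤˣ) : ℤ) : ℝ) * X (C i).1)

/-- The objective of the Max-`P` relaxation: the polynomial `(1/|I|) ∑_{C ∈ I} P(C(x))`. -/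
noncomputable def objectivePoly {k n : ℕ} (P : (Fin k → ℤˣ) → Bool) (I : Finset (Clause k n)) :
    MvPolynomial (Fin n) ℝ :=
  MvPolynomial.C (1 / (I.card : ℝ)) * ∑ C ∈ I, clausePoly (predValue P) C

/-- The set of objective values of the degree-`d` SOS relaxation of the Max-`P` instance `I`: the
numbers `E[(1/|I|) ∑_{C ∈ I} P(C(x))]`, for the degree-`d` pseudo-expectation operators `E` that
satisfy the constraints `x_j² = 1`. -/
def sosObjectiveValues {k n : ℕ} (P : (Fin k → ℤˣ) → Bool) (I : Finset (Clause k n)) (d : ℕ) :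
    Set ℝ :=
  {v | ∃ E : polyLE n d →ₗ[ℝ] ℝ, IsPseudoExpectation E ∧
    (∀ j : Fin n, SatisfiesConstraint E (MvPolynomial.X j ^ 2 - 1)) ∧
    ∃ h : objectivePoly P I ∈ polyLE n d, v = E ⟨objectivePoly P I, h⟩}

/-- The degree-`d` SOS relaxation of the Max-`P` instance `I` has (optimal) value `v`: the maximum
of its objective exists and is equal to `v`. -/
def HasSOSValue {k n : ℕ} (P : (Fin k → ℤˣ) → Bool) (I : Finset (Clause k n)) (d : ℕ)
    (v : ℝ) : Prop :=
  IsGreatest (sosObjectiveValues P I d) v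

/-! Take a random sparse `k`-uniform hypergraph with linearly many hyperedges and put suitable signs
on its incidences. A Chernoff and union bound over the assignments gives soundness. For
completeness, give hyperedge `j` the local density `1 + ν j x = 2 ^ k * μ (C_j x)`. Pairwise
independence of `μ` kills its Fourier coefficients of order one and two, so `ν j` involves only
monomials in at least three variables of `j`. The pseudo-expectation integrates against `∏ j, (1 + ν
j)`, expanded and truncated (`truncatedDensity`).

Positivity rests on the predimension `|A| - (k - 3/2) |spanned A|`. It is submodular, and its small
strong sets are closed under intersection (`inter_mem_strongSets`) and cover every set of at most
`d` variables (`exists_mem_strongSets`). If each hyperedge of a family selects at least three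
incidences and no vertex outside two strong sets `A ∪ B` is selected exactly once, then a double
count puts every hyperedge inside `A` or inside `B` (`IsStrong.subset_spanned_union`). Hence all
other terms of the expansion average to zero against functions on `A ∪ B`, and there the functional
is integration against the honest density `∏ (1 + ν j)` over the hyperedges spanned by `A` or by `B`
(`expect_mul_truncatedDensity`).

So the functional is a positive measure on each strong set, and two strong sets are conditionally
independent given their intersection. A Gram–Schmidt argument along the intersection-closed family
then makes it nonnegative on squares (`apply_mul_self_nonneg_of_conditionallyIndependent`). Clauses
hold with pseudo-expectation `1` because the local densities live on `P⁻¹(1)`. -/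

/-! ### Predimension and strong sets in sparse hypergraphs -/

section Predimension

open Finset

variable {V J : Type*} [DecidableEq V] {k : ℕ}

/-- The number of vertices of the hyperedge `j` (with multiplicity) in `A`. -/
def incidence (e : J → Fin k → V) (j : J) (A : Finset V) : ℕ :=
  #(univ.filter fun i => e j i ∈ A)

theorem incidence_mono (e : J → Fin k → V) (j : J) {A B : Finset V} (h : A ⊆ B) :
    incidence e j A ≤ incidence e j B :=
  card_le_card (monotone_filter_right _ fun _ _ hi => h hi)

/-- The number of selected incidences `(j, i)` with `i ∈ S j` at the vertex `v`. -/
def selDegree (e : J → Fin k → V) (F : Finset J) (S : J → Finset (Fin k)) (v : V) : ℕ :=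
  ∑ j ∈ F, #((S j).filter fun i => e j i = v)

variable [Fintype J]

/-- The hyperedges all of whose vertices lie in `A`. -/
def spanned (e : J → Fin k → V) (A : Finset V) : Finset J :=
  univ.filter fun j => ∀ i, e j i ∈ A

theorem mem_spanned {e : J → Fin k → V} {A : Finset V} {j : J} :
    j ∈ spanned e A ↔ ∀ i, e j i ∈ A := by
  simp [spanned]

theorem spanned_mono {e : J → Fin k → V} {A B : Finset V} (h : A ⊆ B) :
    spanned e A ⊆ spanned e B := fun _ hj =>
  mem_spanned.2 fun i => h (mem_spanned.1 hj i)

theorem spanned_inter [DecidableEq J] (e : J → Fin k → V) (A B : Finset V) :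
    spanned e (A ∩ B) = spanned e A ∩ spanned e B := by
  ext j
  simp [mem_spanned, forall_and]

theorem spanned_empty (e : J → Fin k → V) (hk : k ≠ 0) : spanned e ∅ = ∅ := by
  ext j
  simpa [mem_spanned] using ⟨⟨0, Nat.pos_of_ne_zero hk⟩⟩

/-- Twice the predimension `|A| - (k - 3/2) |spanned A|` of a set of vertices of a `k`-uniform
hypergraph. -/
def predim (e : J → Fin k → V) (A : Finset V) : ℤ :=
  2 * (#A : ℤ) - (2 * k - 3) * (#(spanned e A) : ℤ)

/-- Cardinality is modular, the number of spanned hyperedges is supermodular, and it enters with the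
factor `-(2k - 3) ≤ 0`. -/
theorem predim_union_add_inter_le (hk : 2 ≤ k) (e : J → Fin k → V) (A B : Finset V) :
    predim e (A ∪ B) + predim e (A ∩ B) ≤ predim e A + predim e B := by
  classical
  have h1 := card_union_add_card_inter A B
  have h2 := card_union_add_card_inter (spanned e A) (spanned e B)
  have h3 : #(spanned e A ∪ spanned e B) ≤ #(spanned e (A ∪ B)) :=
    card_le_card (union_subset (spanned_mono subset_union_left) (spanned_mono subset_union_right))
  rw [← spanned_inter] at h2
  unfold predim
  zify at h1 h2 h3 hk
  nlinarith

/-- Every set of at most `M` vertices spans at most `|A| / (k - 5/4)` hyperedges. -/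
def SparseUpTo (e : J → Fin k → V) (M : ℕ) : Prop :=
  ∀ A : Finset V, #A ≤ M → (4 * k - 5 : ℤ) * #(spanned e A) ≤ 4 * #A

/-- Every proper extension of `A` with at most `M` vertices has larger predimension. -/
def IsStrong (e : J → Fin k → V) (M : ℕ) (A : Finset V) : Prop :=
  ∀ A' : Finset V, A ⊂ A' → #A' ≤ M → predim e A < predim e A'

/-- The gap between `k - 5/4` in the sparsity and `k - 3/2` in the predimension leaves `predim e A ≥
|spanned A| / 2`, so small predimension bounds the spanned hyperedges and then the vertices. -/
theorem SparseUpTo.card_spanned_le {e : J → Fin k → V} {M d : ℕ} (h : SparseUpTo e M)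
    {A : Finset V} (hA : #A ≤ M) (hd : predim e A ≤ 2 * d) : #(spanned e A) ≤ 4 * d := by
  have := h A hA
  unfold predim at hd
  zify
  linarith

theorem SparseUpTo.card_le {e : J → Fin k → V} {M d : ℕ} (hk : 2 ≤ k) (h : SparseUpTo e M)
    {A : Finset V} (hA : #A ≤ M) (hd : predim e A ≤ 2 * d) : #A ≤ 4 * k * d := by
  have h1 := h.card_spanned_le hA hd
  unfold predim at hd
  zify at h1 hk ⊢
  nlinarith

/-- The small strong sets of vertices. -/
def strongSets [Fintype V] (e : J → Fin k → V) (M d : ℕ) : Set (Finset V) :=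
  {A | #A ≤ M ∧ predim e A ≤ 2 * d ∧ IsStrong e M A}

/-- Every set with at most `M` vertices has an extension that is strong and is not exceeded in
predimension by the sets between the two. -/
theorem exists_strong_superset [Fintype V] (e : J → Fin k → V) {M : ℕ} {S : Finset V}
    (hS : #S ≤ M) :
    ∃ A, S ⊆ A ∧ #A ≤ M ∧ IsStrong e M A ∧
      ∀ B, S ⊆ B → #B ≤ M → predim e A ≤ predim e B := by
  -- The factor `|V| + 1` makes this lexicographic: least predimension first, then greatest
  -- cardinality. The tie-break gives the strict inequality in `IsStrong`.
  let w : Finset V → ℤ := fun A => (Fintype.card V + 1) * predim e A - #A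
  obtain ⟨A, hA, hmin⟩ := exists_min_image (univ.filter fun A : Finset V => S ⊆ A ∧ #A ≤ M) w
    ⟨S, by simp [hS]⟩
  simp only [mem_filter, mem_univ, true_and] at hA hmin
  refine ⟨A, hA.1, hA.2, fun A' hAA' hA' => ?_, fun B hB hBM => ?_⟩
  · have h1 := hmin A' ⟨hA.1.trans hAA'.1, hA'⟩
    have h2 := card_lt_card hAA'
    simp only [w] at h1
    zify at h2
    by_contra! h3
    nlinarith
  · have h1 := hmin B ⟨hB, hBM⟩
    have h2 := card_le_univ A
    simp only [w] at h1
    zify at h2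
    by_contra! h3
    have h4 : predim e B + 1 ≤ predim e A := h3
    nlinarith

theorem exists_mem_strongSets [Fintype V] (hk : 2 ≤ k) (e : J → Fin k → V) {M d : ℕ}
    (hM : d ≤ M) {S : Finset V} (hS : #S ≤ d) : ∃ A ∈ strongSets e M d, S ⊆ A := by
  obtain ⟨A, hSA, hA, hst, hmin⟩ := exists_strong_superset e (hS.trans hM)
  refine ⟨A, ⟨hA, (hmin S Subset.rfl (hS.trans hM)).trans ?_, hst⟩, hSA⟩
  unfold predim
  have : (0 : ℤ) ≤ (2 * k - 3) * #(spanned e S) := mul_nonneg (by omega) (by positivity)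
  zify at hS
  linarith

theorem empty_mem_strongSets [Fintype V] (hk : 2 ≤ k) {e : J → Fin k → V} {M d : ℕ}
    (h : SparseUpTo e M) : ∅ ∈ strongSets e M d := by
  have h0 : predim e ∅ = 0 := by simp [predim, spanned_empty e (by omega : k ≠ 0)]
  refine ⟨by simp, by rw [h0]; positivity, fun A hA hAM => ?_⟩
  rw [h0]
  have h1 := h A hAM
  have h2 := card_lt_card hA
  rw [card_empty] at h2
  unfold predim
  by_contra! h3
  have h4 : (0 : ℤ) ≤ #(spanned e A) := by positivity
  have h5 : (#(spanned e A) : ℤ) = 0 := by linarith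
  rw [h5] at h3
  omega

/-- Let `D ⊇ A ∩ B` be strong and of least predimension. For `C = A` or `B`, minimality gives
`predim D ≤ predim (C ∩ D)`, so by submodularity `predim (C ∪ D) ≤ predim C`. As `|C ∪ D| ≤ 8kd ≤
M`, strongness of `C` forces `D ⊆ C`. Hence `D = A ∩ B`. -/
theorem inter_mem_strongSets [Fintype V] (hk : 2 ≤ k) {e : J → Fin k → V} {M d : ℕ}
    (h : SparseUpTo e M) (hM : 8 * k * d ≤ M) {A B : Finset V} (hA : A ∈ strongSets e M d)
    (hB : B ∈ strongSets e M d) : A ∩ B ∈ strongSets e M d := by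
  obtain ⟨D, hD, hDM, hst, hmin⟩ := exists_strong_superset e
    ((card_le_card inter_subset_left).trans hA.1 : #(A ∩ B) ≤ M)
  have hDd : predim e D ≤ 2 * d := (hmin A inter_subset_left hA.1).trans hA.2.1
  have hsub : ∀ C ∈ strongSets e M d, A ∩ B ⊆ C → D ⊆ C := by
    intro C hC hDC
    have h1 := predim_union_add_inter_le hk e C D
    have h2 := hmin (C ∩ D) (subset_inter hDC hD) ((card_le_card inter_subset_left).trans hC.1)
    have h3 := h.card_le hk hC.1 hC.2.1
    have h4 := h.card_le hk hDM hDd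
    have h5 := card_union_le C D
    by_contra hcon
    have h6 := hC.2.2 (C ∪ D) ⟨subset_union_left, fun h' => hcon (subset_union_right.trans h')⟩
      (by linarith)
    linarith
  have hDeq : D = A ∩ B := Subset.antisymm
    (subset_inter (hsub A hA inter_subset_left) (hsub B hB inter_subset_right)) hD
  rw [← hDeq]
  exact ⟨hDM, hDd, hst⟩

/-- Adjoining the vertices `N` of `F` to `A` gains at least `|F|` spanned hyperedges, so strongness
forces `2 |N \ A| > (2k - 3) |F|`. Counting incidence weights, at least two per new vertex, bounds
`2 |N \ A|` from above by `(2k - 3) |F|` plus the difference of the two sums in the conclusion. -/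
theorem IsStrong.sum_incidence_lt {e : J → Fin k → V} {M : ℕ} {A B : Finset V}
    (hA : IsStrong e M A) {F : Finset J} {S : J → Finset (Fin k)} (hS : ∀ j ∈ F, 3 ≤ #(S j))
    (hdeg : ∀ v, v ∉ A ∪ B → selDegree e F S v ≠ 1) (hM : #A + k * #F ≤ M)
    (hF : F.Nonempty) (hbad : ∀ j ∈ F, j ∉ spanned e A) :
    ∑ j ∈ F, incidence e j A < ∑ j ∈ F, incidence e j (B \ A) := by
  classical
  let N : Finset V := F.biUnion fun j => univ.image (e j)
  have hNmem : ∀ v, v ∈ N ↔ ∃ j ∈ F, ∃ i, e j i = v := by simp [N]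
  have hNcard : #N ≤ k * #F := by
    rw [mul_comm]
    exact card_biUnion_le_card_mul _ _ _ fun j _ => card_image_le.trans (by simp)
  let A' := A ∪ N
  have hA' : #A' ≤ M := (card_union_le _ _).trans (by omega)
  have hss : A ⊂ A' := by
    refine ⟨subset_union_left, fun h => ?_⟩
    obtain ⟨j, hj⟩ := hF
    exact hbad j hj (mem_spanned.2 fun i =>
      h (mem_union_right _ ((hNmem _).2 ⟨j, hj, i, rfl⟩)))
  have hlt := hA A' hss hA'
  have hsp : #(spanned e A) + #F ≤ #(spanned e A') := by
    rw [← card_union_of_disjoint]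
    · refine card_le_card (union_subset (spanned_mono subset_union_left) fun j hj => ?_)
      exact mem_spanned.2 fun i => mem_union_right _ ((hNmem _).2 ⟨j, hj, i, rfl⟩)
    · exact disjoint_left.2 fun j hj hjF => hbad j hjF hj
  -- each new vertex receives a total weight of at least two from its incidences
  let wt : J → Fin k → ℕ := fun j i =>
    if e j i ∈ A then 0 else if e j i ∉ B ∧ i ∈ S j then 1 else 2
  have hvert : 2 * #(N \ A) ≤ ∑ j ∈ F, ∑ i, wt j i := by
    have h1 : ∑ j ∈ F, ∑ i, wt j i
        = ∑ j ∈ F, ∑ i, ∑ v ∈ N, if e j i = v then wt j i else 0 := by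
      refine sum_congr rfl fun j hj => sum_congr rfl fun i _ => ?_
      rw [sum_ite_eq, if_pos ((hNmem _).2 ⟨j, hj, i, rfl⟩)]
    have h2 : ∑ j ∈ F, ∑ i, wt j i
        = ∑ v ∈ N, ∑ j ∈ F, ∑ i, if e j i = v then wt j i else 0 := by
      rw [h1, sum_comm (s := N)]
      exact sum_congr rfl fun j _ => sum_comm
    rw [h2]
    calc 2 * #(N \ A) = ∑ v ∈ N \ A, 2 := by rw [sum_const, smul_eq_mul, mul_comm]
      _ ≤ ∑ v ∈ N \ A, ∑ j ∈ F, ∑ i, (if e j i = v then wt j i else 0) := by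
          refine sum_le_sum fun v hv => ?_
          obtain ⟨hvN, hvA⟩ := mem_sdiff.1 hv
          by_cases hfull : ∃ j ∈ F, ∃ i, e j i = v ∧ wt j i = 2
          · obtain ⟨j, hj, i, hi, hw⟩ := hfull
            calc 2 = if e j i = v then wt j i else 0 := by rw [if_pos hi, hw]
              _ ≤ ∑ i, if e j i = v then wt j i else 0 :=
                  single_le_sum (f := fun i => if e j i = v then wt j i else 0)
                    (fun _ _ => Nat.zero_le _) (mem_univ i)
              _ ≤ _ := single_le_sum (f := fun j => ∑ i, if e j i = v then wt j i else 0)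
                    (fun _ _ => Nat.zero_le _) hj
          · push Not at hfull
            have hin : ∀ j ∈ F, ∀ i, e j i = v → v ∉ B ∧ i ∈ S j ∧ wt j i = 1 := by
              intro j hj i hi
              have := hfull j hj i hi
              simp only [wt, hi, hvA, if_false] at this ⊢
              split_ifs at this ⊢ with h
              · exact ⟨h.1, h.2, rfl⟩
              · exact absurd rfl this
            obtain ⟨j, hj, i, hi⟩ := (hNmem v).1 hvN
            have hvB := (hin j hj i hi).1
            have hd := hdeg v (by simp [hvA, hvB])
            have hdeq : selDegree e F S v
                = ∑ j ∈ F, ∑ i, if e j i = v then wt j i else 0 := by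
              refine sum_congr rfl fun j hj => ?_
              rw [card_filter, ← sum_subset (subset_univ (S j))]
              · refine sum_congr rfl fun i _ => ?_
                split_ifs with h
                · exact (hin j hj i h).2.2.symm
                · rfl
              · intro i _ hi
                split_ifs with h
                · exact absurd (hin j hj i h).2.1 hi
                · rfl
            have hpos : selDegree e F S v ≠ 0 := by
              intro h0
              have := (sum_eq_zero_iff.1 h0) j hj
              rw [card_eq_zero] at this
              exact notMem_empty i (this ▸ mem_filter.2 ⟨(hin j hj i hi).2.1, hi⟩)
            rw [← hdeq]
            omega
      _ ≤ _ := sum_le_sum_of_subset sdiff_subset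
  -- Starting from weight two per incidence, each selection and each incidence in `A` costs one;
  -- only incidences in `B \ A` need a compensating one. At least three selections give the `3`,
  -- which is where `k - 3/2` comes from.
  have hedge : ∀ j ∈ F, ∑ i, wt j i + 3 + incidence e j A ≤ 2 * k + incidence e j (B \ A) := by
    intro j hj
    have h3 := hS j hj
    have hp : ∀ i, wt j i + (if i ∈ S j then 1 else 0) + (if e j i ∈ A then 1 else 0)
        ≤ 2 + (if e j i ∈ B \ A then 1 else 0) := by
      intro i
      simp only [wt, mem_sdiff]
      by_cases h1 : e j i ∈ A <;> by_cases h2 : e j i ∈ B <;> by_cases h4 : i ∈ S j <;>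
        simp [h1, h2, h4]
    have hsum := sum_le_sum fun i (_ : i ∈ (univ : Finset (Fin k))) => hp i
    simp only [sum_add_distrib, sum_const, card_univ, Fintype.card_fin, smul_eq_mul] at hsum
    rw [← card_filter, ← card_filter, ← card_filter] at hsum
    have h5 : #(univ.filter fun i => i ∈ S j) = #(S j) := by simp
    unfold incidence
    omega
  have hsum := sum_le_sum hedge
  simp only [sum_add_distrib, sum_const, smul_eq_mul] at hsum
  have hcA : #A' = #A + #(N \ A) := by
    rw [← card_union_of_disjoint disjoint_sdiff, union_sdiff_self_eq_union]
  unfold predim at hlt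
  by_contra! hcon
  have hk3 : 3 ≤ k := by
    obtain ⟨j, hj⟩ := hF
    exact (hS j hj).trans ((card_le_univ _).trans (by simp))
  zify at hsp hcA hsum hcon hvert hk3
  nlinarith

/-- A system of incidence sets of size at least three whose boundary lies in the union of two strong
sets uses only hyperedges spanned by one of the two sets. -/
theorem IsStrong.subset_spanned_union {e : J → Fin k → V} [DecidableEq J] {M : ℕ}
    {A B : Finset V} (hA : IsStrong e M A) (hB : IsStrong e M B) {F : Finset J}
    {S : J → Finset (Fin k)} (hS : ∀ j ∈ F, 3 ≤ #(S j))
    (hdeg : ∀ v, v ∉ A ∪ B → selDegree e F S v ≠ 1)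
    (hMA : #A + k * #F ≤ M) (hMB : #B + k * #F ≤ M) :
    F ⊆ spanned e A ∪ spanned e B := by
  classical
  let F' := F.filter fun j => j ∉ spanned e A ∧ j ∉ spanned e B
  have hF'F : F' ⊆ F := filter_subset _ _
  by_contra hcon
  have hne : F'.Nonempty := by
    obtain ⟨j, hj, hj'⟩ := not_subset.1 hcon
    exact ⟨j, by simpa [F', hj] using hj'⟩
  have hcard := Nat.mul_le_mul_left k (card_le_card hF'F)
  -- The discarded hyperedges lie inside `A` or inside `B`, so they do not affect degrees outside `A
  -- ∪ B`.
  have hdeg' : ∀ v, v ∉ A ∪ B → selDegree e F' S v ≠ 1 := by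
    intro v hv
    have : selDegree e F' S v = selDegree e F S v := by
      refine sum_subset hF'F fun j hj hj' => ?_
      rw [card_eq_zero, filter_eq_empty_iff]
      rintro i - rfl
      simp only [F', mem_filter, not_and, not_not, hj, true_and] at hj'
      rw [mem_union, not_or] at hv
      by_cases h : j ∈ spanned e A
      · exact hv.1 (mem_spanned.1 h i)
      · exact hv.2 (mem_spanned.1 (hj' h) i)
    rw [this]
    exact hdeg v hv
  -- Used for `(A, B)` and for `(B, A)`, the count says that `F'` has fewer incidences with `A` than
  -- with `B` and conversely.
  have h1 := hA.sum_incidence_lt (fun j hj => hS j (hF'F hj)) hdeg' (by omega) hne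
    fun j hj => (mem_filter.1 hj).2.1
  have h2 := hB.sum_incidence_lt (B := A) (fun j hj => hS j (hF'F hj))
    (fun v hv => hdeg' v (by rwa [union_comm])) (by omega) hne
    fun j hj => (mem_filter.1 hj).2.2
  have h3 := sum_le_sum fun j (_ : j ∈ F') => incidence_mono e j (sdiff_subset : B \ A ⊆ B)
  have h4 := sum_le_sum fun j (_ : j ∈ F') => incidence_mono e j (sdiff_subset : A \ B ⊆ A)
  omega

end Predimension

/-! ### Averages over the cube -/

section CubeAverage

open Finset
open scoped BigOperators

theorem dependsOn_mul {V : Type*} {s : Set V} {f g : (V → ℤˣ) → ℝ} (hf : DependsOn f s) (hg : DependsOn g s) :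
    DependsOn (fun x => f x * g x) s := fun _ _ h => congrArg₂ _ (hf h) (hg h)

variable {V : Type*} [Fintype V] [DecidableEq V]

/-- Exchanging the coordinates of `x` and `y` outside `B` is an involution of the pairs, hence
preserves the average. -/
theorem expect_piecewise (B : Finset V) (h : (V → ℤˣ) → ℝ) :
    𝔼 x : V → ℤˣ, 𝔼 y : V → ℤˣ, h (B.piecewise x y) = 𝔼 x, h x := by
  have h1 : 𝔼 x : V → ℤˣ, 𝔼 y : V → ℤˣ, h (B.piecewise x y)
      = 𝔼 p : (V → ℤˣ) × (V → ℤˣ), h (B.piecewise p.1 p.2) := by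
    rw [← univ_product_univ, expect_product]
  have h2 : 𝔼 p : (V → ℤˣ) × (V → ℤˣ), h p.1 = 𝔼 x, h x := by
    rw [← univ_product_univ, expect_product]
    simp
  rw [h1, ← h2]
  have hinv : Function.Involutive fun p : (V → ℤˣ) × (V → ℤˣ) =>
      (B.piecewise p.1 p.2, B.piecewise p.2 p.1) := by
    rintro ⟨x, y⟩
    ext v <;> by_cases hv : v ∈ B <;> simp [hv]
  exact Fintype.expect_bijective _ hinv.bijective _ _ fun _ => rfl

/-- The average of `h` over the coordinates outside `B`. -/
noncomputable def averageOff (B : Finset V) (h : (V → ℤˣ) → ℝ) (x : V → ℤˣ) : ℝ :=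
  𝔼 y : V → ℤˣ, h (B.piecewise x y)

theorem dependsOn_averageOff {A B : Finset V} {h : (V → ℤˣ) → ℝ} (hh : DependsOn h A) :
    DependsOn (averageOff B h) (A ∩ B : Finset V) := by
  intro x x' hx
  refine expect_congr rfl fun y _ => hh fun v hv => ?_
  by_cases hvB : v ∈ B
  · simpa [hvB] using hx v (mem_coe.2 (mem_inter.2 ⟨hv, hvB⟩))
  · simp [hvB]

theorem expect_averageOff_mul {B : Finset V} (u : (V → ℤˣ) → ℝ) {v : (V → ℤˣ) → ℝ}
    (hv : DependsOn v B) : 𝔼 x, averageOff B u x * v x = 𝔼 x, u x * v x := by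
  rw [← expect_piecewise B fun x => u x * v x]
  refine expect_congr rfl fun x _ => ?_
  rw [averageOff, expect_mul]
  refine expect_congr rfl fun y _ => ?_
  congr 1
  exact hv fun i hi => by simp [mem_coe.1 hi]

/-- A monomial function averages to zero against a function that does not depend on some variable
of odd degree. -/
theorem expect_mul_prod_eq_zero {ι : Type*} {s : Finset ι} (w : ι → V) {g : (V → ℤˣ) → ℝ}
    {W : Finset V} (hg : DependsOn g W) {v : V} (hv : v ∉ W)
    (hodd : Odd #(s.filter fun i => w i = v)) :
    𝔼 x : V → ℤˣ, g x * ∏ i ∈ s, (((x (w i) : ℤˣ) : ℤ) : ℝ) = 0 := by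
  let φ : (V → ℤˣ) → (V → ℤˣ) := fun x => Function.update x v (-x v)
  have hinv : Function.Involutive φ := by
    intro x
    simp [φ]
  have hflip : ∀ x, g (φ x) * ∏ i ∈ s, (((φ x (w i) : ℤˣ) : ℤ) : ℝ)
      = -(g x * ∏ i ∈ s, (((x (w i) : ℤˣ) : ℤ) : ℝ)) := by
    intro x
    have h1 : g (φ x) = g x := hg fun i hi => by
      have : i ≠ v := by rintro rfl; exact hv hi
      simp [φ, this]
    have h2 : ∀ i ∈ s, (((φ x (w i) : ℤˣ) : ℤ) : ℝ)
        = (if w i = v then -1 else 1) * (((x (w i) : ℤˣ) : ℤ) : ℝ) := by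
      intro i _
      by_cases h : w i = v
      · simp [φ, h]
      · simp [φ, h]
    rw [h1, prod_congr rfl h2, prod_mul_distrib, prod_ite, prod_const, prod_const_one,
      hodd.neg_one_pow]
    ring
  have h3 := Fintype.expect_bijective φ hinv.bijective
    (fun x => g (φ x) * ∏ i ∈ s, (((φ x (w i) : ℤˣ) : ℤ) : ℝ))
    (fun x => g x * ∏ i ∈ s, (((x (w i) : ℤˣ) : ℤ) : ℝ)) fun _ => rfl
  rw [expect_congr rfl fun x _ => hflip x, expect_neg_distrib] at h3
  linarith

end CubeAverage

/-! ### The truncated density is a true density near strong sets -/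

section LocalDensity

open Finset
open scoped BigOperators

variable {V J : Type*} [DecidableEq V] [Fintype J] {k : ℕ}

/-- The functions `ν j` on the cube are combinations of the monomials in at least three of the
variables of the hyperedge `j`. -/
def HasHighFourierSupport (e : J → Fin k → V) (ν : J → (V → ℤˣ) → ℝ) : Prop :=
  ∃ b : J → Finset (Fin k) → ℝ, ∀ j x, ν j x = ∑ S : {S : Finset (Fin k) // 3 ≤ #S},
    b j S * ∏ i ∈ S.1, (((x (e j i) : ℤˣ) : ℤ) : ℝ)

theorem HasHighFourierSupport.dependsOn {e : J → Fin k → V} {ν : J → (V → ℤˣ) → ℝ}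
    (hν : HasHighFourierSupport e ν) {A : Finset V} {j : J} (hj : j ∈ spanned e A) :
    DependsOn (ν j) A := by
  obtain ⟨b, hb⟩ := hν
  intro x y hxy
  rw [hb, hb]
  refine sum_congr rfl fun S _ => congrArg _ (prod_congr rfl fun i _ => ?_)
  rw [hxy _ (mem_coe.2 (mem_spanned.1 hj i))]

theorem HasHighFourierSupport.dependsOn_prod (hν : HasHighFourierSupport e ν) {A : Finset V}
    {F : Finset J} (hF : F ⊆ spanned e A) : DependsOn (fun x => ∏ j ∈ F, (1 + ν j x)) A :=
  fun _ _ h => prod_congr rfl fun _ hj => congrArg (1 + ·) (hν.dependsOn (hF hj) h)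

variable [Fintype V] [DecidableEq J]

/-- Each term of the Fourier expansion selects at least three incidences in every hyperedge of `F`.
As `F` is not covered by the two spanned families, some vertex outside `A ∪ B` is selected exactly
once; flipping that coordinate changes the sign of the term. -/
theorem HasHighFourierSupport.expect_mul_prod_eq_zero {e : J → Fin k → V}
    {ν : J → (V → ℤˣ) → ℝ} (hν : HasHighFourierSupport e ν) {M : ℕ} {A B : Finset V}
    (hA : IsStrong e M A) (hB : IsStrong e M B) {g : (V → ℤˣ) → ℝ}
    (hg : DependsOn g (A ∪ B : Finset V)) {F : Finset J} (hMA : #A + k * #F ≤ M)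
    (hMB : #B + k * #F ≤ M) (hF : ¬ F ⊆ spanned e A ∪ spanned e B) :
    𝔼 x, g x * ∏ j ∈ F, ν j x = 0 := by
  obtain ⟨b, hb⟩ := hν
  have hexp : ∀ x, g x * ∏ j ∈ F, ν j x
      = ∑ S ∈ Fintype.piFinset fun _ : F => (univ : Finset {S : Finset (Fin k) // 3 ≤ #S}),
        (∏ j : F, b j (S j)) * (g x * ∏ j : F, ∏ i ∈ (S j).1, (((x (e j i) : ℤˣ) : ℤ) : ℝ)) := by
    intro x
    rw [← prod_coe_sort F fun j => ν j x]
    simp_rw [hb]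
    rw [prod_univ_sum, mul_sum]
    refine sum_congr rfl fun S _ => ?_
    rw [prod_mul_distrib]
    ring
  simp_rw [hexp]
  rw [expect_sum_comm]
  refine sum_eq_zero fun S _ => ?_
  rw [← mul_expect]
  refine mul_eq_zero_of_right _ ?_
  let S' : J → Finset (Fin k) := fun j => if h : j ∈ F then (S ⟨j, h⟩).1 else ∅
  have hS' : ∀ j ∈ F, 3 ≤ #(S' j) := fun j hj => by simpa [S', hj] using (S ⟨j, hj⟩).2
  obtain ⟨v, hv, hdeg⟩ : ∃ v, v ∉ A ∪ B ∧ Odd (selDegree e F S' v) := by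
    by_contra! hcon
    refine hF (hA.subset_spanned_union hB hS' (fun v hv h1 => hcon v hv ?_) hMA hMB)
    rw [h1]
    exact odd_one
  have hprod : ∀ x : V → ℤˣ, ∏ j : F, ∏ i ∈ (S j).1, (((x (e j i) : ℤˣ) : ℤ) : ℝ)
      = ∏ p ∈ F.sigma S', (((x (e p.1 p.2) : ℤˣ) : ℤ) : ℝ) := by
    intro x
    rw [prod_sigma, ← prod_coe_sort F]
    refine prod_congr rfl fun j _ => ?_
    simp [S']
  simp_rw [hprod]
  refine _root_.expect_mul_prod_eq_zero (fun p : (_ : J) × Fin k => e p.1 p.2) hg hv ?_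
  convert hdeg using 1
  rw [selDegree, ← card_sigma]
  congr 1
  ext ⟨j, i⟩
  simp [and_assoc]

/-- The density of the pseudo-distribution: the product `∏ j, (1 + ν j)` expanded and truncated
after the terms with `t` factors. -/
noncomputable def truncatedDensity (ν : J → (V → ℤˣ) → ℝ) (t : ℕ) (x : V → ℤˣ) : ℝ :=
  ∑ F ∈ univ.filter fun F : Finset J => #F ≤ t, ∏ j ∈ F, ν j x

/-- Each of `A`, `B` spans at most `4d` hyperedges, so truncation at `8d` keeps every term of the
product on the right. The remaining terms vanish; the lemma for this needs `|A| + k |F| ≤ 4kd + 8kd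
≤ M`, whence the constant `12`. -/
theorem expect_mul_truncatedDensity {e : J → Fin k → V} {ν : J → (V → ℤˣ) → ℝ}
    (hν : HasHighFourierSupport e ν) {M d : ℕ} (hk : 2 ≤ k) (he : SparseUpTo e M)
    (hM : 12 * k * d ≤ M) {A B : Finset V} (hA : A ∈ strongSets e M d)
    (hB : B ∈ strongSets e M d) {g : (V → ℤˣ) → ℝ} (hg : DependsOn g (A ∪ B : Finset V)) :
    𝔼 x, g x * truncatedDensity ν (8 * d) x
      = 𝔼 x, g x * ∏ j ∈ spanned e A ∪ spanned e B, (1 + ν j x) := by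
  have hcA := he.card_le hk hA.1 hA.2.1
  have hcB := he.card_le hk hB.1 hB.2.1
  have hsA := he.card_spanned_le hA.1 hA.2.1
  have hsB := he.card_spanned_le hB.1 hB.2.1
  have hsAB := card_union_le (spanned e A) (spanned e B)
  have h1 : ∀ x, g x * ∏ j ∈ spanned e A ∪ spanned e B, (1 + ν j x)
      = ∑ F ∈ (spanned e A ∪ spanned e B).powerset, g x * ∏ j ∈ F, ν j x := by
    intro x
    rw [prod_one_add, mul_sum]
  have h2 : ∀ x, g x * truncatedDensity ν (8 * d) x
      = ∑ F ∈ univ.filter fun F : Finset J => #F ≤ 8 * d, g x * ∏ j ∈ F, ν j x := by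
    intro x
    rw [truncatedDensity, mul_sum]
  simp_rw [h1, h2]
  rw [expect_sum_comm, expect_sum_comm]
  symm
  refine sum_subset (fun F hF => ?_) fun F hF hF' => ?_
  · have := card_le_card (mem_powerset.1 hF)
    simp only [mem_filter, mem_univ, true_and]
    omega
  · have hF8 : #F ≤ 8 * d := (mem_filter.1 hF).2
    have := Nat.mul_le_mul_left k hF8
    exact hν.expect_mul_prod_eq_zero hA.2.2 hB.2.2 hg (by nlinarith) (by nlinarith)
      fun h => hF' (mem_powerset.2 h)

end LocalDensity

/-! ### Positivity from conditional independence -/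

section PositiveSemidefinite

open Finset
open scoped BigOperators

/-- Orthogonal projection with respect to a (possibly degenerate) weighted inner product. -/
theorem exists_weighted_projection {X : Type*} [Fintype X] (w : X → ℝ) (hw : ∀ x, 0 ≤ w x)
    (U : Submodule ℝ (X → ℝ)) (f : X → ℝ) :
    ∃ u ∈ U, ∀ h ∈ U, ∑ x, (f x - u x) * h x * w x = 0 := by
  -- Scaling by `√w` turns the weighted form into the Euclidean one. `T` need not be injective: any
  -- preimage of the projection onto `U.map T` serves.
  let T : (X → ℝ) →ₗ[ℝ] EuclideanSpace ℝ X :=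
    { toFun := fun h => WithLp.toLp 2 fun x => √(w x) * h x
      map_add' := fun a b => by ext x; simp [mul_add]
      map_smul' := fun c a => by ext x; simp; ring }
  obtain ⟨u, hu, huT⟩ := Submodule.mem_map.1 ((U.map T).starProjection_apply_mem (T f))
  refine ⟨u, hu, fun h hh => ?_⟩
  have := (U.map T).starProjection_inner_eq_zero (T f) (T h) (Submodule.mem_map_of_mem hh)
  rw [← huT, ← map_sub, PiLp.inner_apply] at this
  rw [← this]
  refine sum_congr rfl fun x _ => ?_
  have hs := Real.mul_self_sqrt (hw x)
  simp only [T, LinearMap.coe_mk, AddHom.coe_mk, Pi.sub_apply, RCLike.inner_apply, conj_trivial]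
  linear_combination (-(f x - u x) * h x) * hs

variable {V : Type*}

/-- The space of functions on the cube that depend only on the coordinates in `A`. -/
def dependsOnSubmodule (A : Finset V) : Submodule ℝ ((V → ℤˣ) → ℝ) where
  carrier := {f | DependsOn f A}
  add_mem' hf hg := fun _ _ h => congrArg₂ (· + ·) (hf h) (hg h)
  zero_mem' := fun _ _ _ => rfl
  smul_mem' c _ hf := fun _ _ h => congrArg (c * ·) (hf h)

theorem dependsOnSubmodule_mono {A B : Finset V} (h : A ⊆ B) :
    dependsOnSubmodule A ≤ dependsOnSubmodule B := fun _ hf =>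
  DependsOn.mono (coe_subset.2 h) hf

variable [Fintype V] [DecidableEq V]

/-- A functional that is given by a measure on the functions of each set of an intersection-closed
family, and for which these sets are conditionally independent given their intersections, is
nonnegative on the squares of sums of such functions. -/
theorem apply_mul_self_nonneg_of_conditionallyIndependent (Λ : ((V → ℤˣ) → ℝ) →ₗ[ℝ] ℝ)
    (𝒞 : Finset (Finset V)) (hinter : ∀ A ∈ 𝒞, ∀ B ∈ 𝒞, A ∩ B ∈ 𝒞)
    (hmeas : ∀ A ∈ 𝒞, ∃ w : (V → ℤˣ) → ℝ, (∀ x, 0 ≤ w x) ∧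
      ∀ f ∈ dependsOnSubmodule A, Λ f = ∑ x, f x * w x)
    (hproj : ∀ A ∈ 𝒞, ∀ B ∈ 𝒞, ∀ g ∈ dependsOnSubmodule B,
      ∃ g' ∈ dependsOnSubmodule (A ∩ B), ∀ f ∈ dependsOnSubmodule A, Λ (f * g) = Λ (f * g'))
    {p : (V → ℤˣ) → ℝ} (hp : p ∈ ⨆ A ∈ 𝒞, dependsOnSubmodule A) : 0 ≤ Λ (p * p) := by
  induction 𝒞 using Finset.strongInduction generalizing p with
  | H 𝒞 ih =>
    rcases 𝒞.eq_empty_or_nonempty with rfl | hne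
    · have : p = 0 := by simpa using hp
      simp [this]
    -- Removing a maximal member keeps the family closed under intersection.
    obtain ⟨A, hA, hmax⟩ := 𝒞.exists_maximal hne
    have hmem : ∀ B ∈ 𝒞.erase A, B ∈ 𝒞 := fun B hB => mem_of_mem_erase hB
    have hAB : ∀ B ∈ 𝒞.erase A, ¬ A ⊆ B := fun B hB h =>
      (mem_erase.1 hB).1 (Subset.antisymm (hmax (hmem B hB) h) h)
    have hlow : ∀ B ∈ 𝒞.erase A, A ∩ B ∈ 𝒞.erase A := fun B hB =>
      mem_erase.2 ⟨fun h => hAB B hB (inter_eq_left.1 h), hinter A hA B (hmem B hB)⟩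
    obtain ⟨U, hBU, hUA, hUle⟩ : ∃ U : Submodule ℝ ((V → ℤˣ) → ℝ),
        (∀ B ∈ 𝒞.erase A, B ⊆ A → dependsOnSubmodule B ≤ U) ∧ U ≤ dependsOnSubmodule A ∧
          U ≤ ⨆ B ∈ 𝒞.erase A, dependsOnSubmodule B :=
      ⟨⨆ B ∈ (𝒞.erase A).filter (· ⊆ A), dependsOnSubmodule B,
        fun B hB hBA => le_iSup₂_of_le B (mem_filter.2 ⟨hB, hBA⟩) le_rfl,
        iSup₂_le fun B hB => dependsOnSubmodule_mono (mem_filter.1 hB).2,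
        iSup₂_le fun B hB => le_iSup₂_of_le B (mem_filter.1 hB).1 le_rfl⟩
    obtain ⟨f, hf, q, hq, rfl⟩ : ∃ f ∈ dependsOnSubmodule A,
        ∃ q ∈ ⨆ B ∈ 𝒞.erase A, dependsOnSubmodule B, f + q = p := by
      rw [← insert_erase hA, Finset.iSup_insert] at hp
      exact Submodule.mem_sup.1 hp
    obtain ⟨w, hw0, hw⟩ := hmeas A hA
    have hmulA : ∀ a ∈ dependsOnSubmodule A, ∀ b ∈ dependsOnSubmodule A,
        a * b ∈ dependsOnSubmodule A := fun a ha b hb _ _ h =>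
      congrArg₂ (· * ·) (ha h) (hb h)
    -- Gram–Schmidt: with `p = f + q`, the part `f - u` is orthogonal to `U`, and `u + q` is a sum
    -- over the smaller family. Once the cross term vanishes, `Λ (p * p)` is the sum of the two
    -- squares.
    obtain ⟨u, hu, huU⟩ := exists_weighted_projection w hw0 U f
    have hfu : f - u ∈ dependsOnSubmodule A := sub_mem hf (hUA hu)
    have horthU : ∀ h ∈ U, Λ ((f - u) * h) = 0 := fun h hh => by
      rw [hw _ (hmulA _ hfu _ (hUA hh))]
      exact huU h hh
    -- For `g` on `B`, conditional independence replaces `g` by a function on `A ∩ B`, which lies in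
    -- `U`. So orthogonality to `U` extends to all remaining members.
    have horth : (⨆ B ∈ 𝒞.erase A, dependsOnSubmodule B)
        ≤ LinearMap.ker (Λ.comp (LinearMap.mulLeft ℝ (f - u))) := by
      refine iSup₂_le fun B hB g hg => ?_
      obtain ⟨g', hg', hgg'⟩ := hproj A hA B (hmem B hB) g hg
      rw [LinearMap.mem_ker, LinearMap.comp_apply, LinearMap.mulLeft_apply, hgg' _ hfu]
      exact horthU _ (hBU _ (hlow B hB) inter_subset_left hg')
    have huq : u + q ∈ ⨆ B ∈ 𝒞.erase A, dependsOnSubmodule B := add_mem (hUle hu) hq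
    have h1 : Λ ((f - u) * (u + q)) = 0 := horth huq
    have h2 : 0 ≤ Λ ((f - u) * (f - u)) := by
      rw [hw _ (hmulA _ hfu _ hfu)]
      exact sum_nonneg fun x _ => mul_nonneg (mul_self_nonneg _) (hw0 x)
    have h3 : 0 ≤ Λ ((u + q) * (u + q)) :=
      ih _ (erase_ssubset hA)
        (fun B hB C hC => by
          refine mem_erase.2 ⟨fun h => hAB B hB ?_, hinter B (hmem B hB) C (hmem C hC)⟩
          rw [← h]
          exact inter_subset_left)
        (fun B hB => hmeas B (hmem B hB))
        (fun B hB C hC => hproj B (hmem B hB) C (hmem C hC)) huq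
    have h4 : (f + q) * (f + q)
        = (f - u) * (f - u) + (2 : ℝ) • ((f - u) * (u + q)) + (u + q) * (u + q) := by
      ext x
      simp
      ring
    rw [h4, map_add, map_add, map_smul, h1]
    simp only [smul_zero, add_zero]
    exact add_nonneg h2 h3

variable {J : Type*} [Fintype J] {k : ℕ}

/-- The functional on the functions on the cube given by the truncated density. -/
noncomputable def pseudoFunctional (ν : J → (V → ℤˣ) → ℝ) (t : ℕ) :
    ((V → ℤˣ) → ℝ) →ₗ[ℝ] ℝ where
  toFun g := 𝔼 x, g x * truncatedDensity ν t x
  map_add' a b := by simp [add_mul, expect_add_distrib]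
  map_smul' c a := by simp [mul_assoc, mul_expect]

theorem pseudoFunctional_apply (ν : J → (V → ℤˣ) → ℝ) (t : ℕ) (g : (V → ℤˣ) → ℝ) :
    pseudoFunctional ν t g = 𝔼 x, g x * truncatedDensity ν t x := rfl

variable [DecidableEq J] {e : J → Fin k → V} {ν : J → (V → ℤˣ) → ℝ} {M d : ℕ}

theorem pseudoFunctional_apply_of_dependsOn (hν : HasHighFourierSupport e ν) (hk : 2 ≤ k)
    (he : SparseUpTo e M) (hM : 12 * k * d ≤ M) {A : Finset V} (hA : A ∈ strongSets e M d)
    {g : (V → ℤˣ) → ℝ} (hg : DependsOn g A) :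
    pseudoFunctional ν (8 * d) g = 𝔼 x, g x * ∏ j ∈ spanned e A, (1 + ν j x) := by
  rw [pseudoFunctional_apply,
    expect_mul_truncatedDensity hν hk he hM hA hA (by rwa [union_self]), union_self]

theorem pseudoFunctional_conditionallyIndependent (hν : HasHighFourierSupport e ν) (hk : 2 ≤ k)
    (he : SparseUpTo e M) (hM : 12 * k * d ≤ M) {A B : Finset V} (hA : A ∈ strongSets e M d)
    (hB : B ∈ strongSets e M d) {g : (V → ℤˣ) → ℝ} (hg : g ∈ dependsOnSubmodule B) :
    ∃ g' ∈ dependsOnSubmodule (A ∩ B), ∀ f ∈ dependsOnSubmodule A,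
      pseudoFunctional ν (8 * d) (f * g) = pseudoFunctional ν (8 * d) (f * g') := by
  -- On `A ∪ B` the density factors into the part spanned by `A` and the hyperedges of `B` not
  -- spanned by `A`. Integrating the latter, times `g`, over the coordinates outside `A` leaves a
  -- function on `A ∩ B`.
  let u : (V → ℤˣ) → ℝ := fun x => g x * ∏ j ∈ spanned e B \ spanned e A, (1 + ν j x)
  have hu : DependsOn u B := dependsOn_mul hg (hν.dependsOn_prod sdiff_subset)
  have hg' := dependsOn_averageOff (B := A) hu
  rw [inter_comm] at hg'
  refine ⟨averageOff A u, hg', fun f hf => ?_⟩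
  have hw := hν.dependsOn_prod (Subset.refl (spanned e A))
  have hfw := dependsOn_mul hf hw
  have h1 : DependsOn (f * g) (A ∪ B : Finset V) :=
    dependsOn_mul (dependsOnSubmodule_mono subset_union_left hf)
      (dependsOnSubmodule_mono subset_union_right hg)
  have h2 : DependsOn (f * averageOff A u) A :=
    dependsOn_mul hf (dependsOnSubmodule_mono inter_subset_left hg')
  rw [pseudoFunctional_apply_of_dependsOn hν hk he hM hA h2, pseudoFunctional_apply,
    expect_mul_truncatedDensity hν hk he hM hA hB h1]
  calc _ = 𝔼 x, u x * (f x * ∏ j ∈ spanned e A, (1 + ν j x)) := by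
        refine expect_congr rfl fun x _ => ?_
        rw [← union_sdiff_self_eq_union, prod_union disjoint_sdiff, Pi.mul_apply]
        ring
    _ = 𝔼 x, averageOff A u x * (f x * ∏ j ∈ spanned e A, (1 + ν j x)) :=
        (expect_averageOff_mul u hfw).symm
    _ = _ := by
        refine expect_congr rfl fun x _ => ?_
        rw [Pi.mul_apply]
        ring

/-- The functional is nonnegative on the squares of the sums of functions of at most `d`
coordinates. -/
theorem pseudoFunctional_mul_self_nonneg (hν : HasHighFourierSupport e ν)
    (hpos : ∀ j x, 0 ≤ 1 + ν j x) (hk : 2 ≤ k) (he : SparseUpTo e M) (hM : 12 * k * d ≤ M)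
    {p : (V → ℤˣ) → ℝ} (hp : p ∈ ⨆ S ∈ {S : Finset V | #S ≤ d}, dependsOnSubmodule S) :
    0 ≤ pseudoFunctional ν (8 * d) (p * p) := by
  classical
  refine apply_mul_self_nonneg_of_conditionallyIndependent _
    (univ.filter fun A => A ∈ strongSets e M d) ?_ ?_ ?_ ?_
  · intro A hA B hB
    simp only [mem_filter, mem_univ, true_and] at hA hB ⊢
    exact inter_mem_strongSets hk he (by nlinarith) hA hB
  · intro A hA
    refine ⟨fun x => (Fintype.card (V → ℤˣ) : ℝ)⁻¹ * ∏ j ∈ spanned e A, (1 + ν j x),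
      fun x => mul_nonneg (by positivity) (prod_nonneg fun j _ => hpos j x), fun f hf => ?_⟩
    rw [pseudoFunctional_apply_of_dependsOn hν hk he hM (mem_filter.1 hA).2 hf,
      Fintype.expect_eq_sum_div_card, sum_div]
    exact sum_congr rfl fun x _ => by ring
  · intro A hA B hB g hg
    exact pseudoFunctional_conditionallyIndependent hν hk he hM (mem_filter.1 hA).2
      (mem_filter.1 hB).2 hg
  · have hle : (⨆ S ∈ {S : Finset V | #S ≤ d}, dependsOnSubmodule S)
        ≤ ⨆ A ∈ univ.filter fun A => A ∈ strongSets e M d, dependsOnSubmodule A := ?_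
    · exact hle hp
    refine iSup₂_le fun S hS => ?_
    obtain ⟨A, hA, hSA⟩ := exists_mem_strongSets hk e (M := M) (by nlinarith) hS
    exact le_iSup₂_of_le A (mem_filter.2 ⟨mem_univ _, hA⟩) (dependsOnSubmodule_mono hSA)

theorem pseudoFunctional_one (hν : HasHighFourierSupport e ν) (hk : 2 ≤ k)
    (he : SparseUpTo e M) (hM : 12 * k * d ≤ M) : pseudoFunctional ν (8 * d) 1 = 1 := by
  rw [pseudoFunctional_apply_of_dependsOn hν hk he hM (empty_mem_strongSets hk he)
    (fun _ _ _ => rfl), spanned_empty e (by omega)]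
  simp

/-- The functional satisfies every hyperedge constraint that the local densities satisfy. -/
theorem pseudoFunctional_eq_one (hν : HasHighFourierSupport e ν) (hk : 2 ≤ k)
    (he : SparseUpTo e M) (hM : 12 * k * d ≤ M) (hkd : k ≤ d) {j : J} {g : (V → ℤˣ) → ℝ}
    (hg : DependsOn g (univ.image (e j) : Finset V))
    (hsupp : ∀ x, g x * (1 + ν j x) = 1 + ν j x) : pseudoFunctional ν (8 * d) g = 1 := by
  obtain ⟨A, hA, hSA⟩ := exists_mem_strongSets hk e (M := M) (d := d) (by nlinarith)
    (S := univ.image (e j)) (card_image_le.trans (by simpa using hkd))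
  have hj : j ∈ spanned e A := mem_spanned.2 fun i => hSA (mem_image_of_mem _ (mem_univ i))
  rw [pseudoFunctional_apply_of_dependsOn hν hk he hM hA (dependsOnSubmodule_mono hSA hg)]
  refine Eq.trans ?_ (pseudoFunctional_one hν hk he hM)
  rw [pseudoFunctional_apply_of_dependsOn hν hk he hM hA (fun _ _ _ => rfl)]
  refine expect_congr rfl fun x _ => ?_
  rw [← mul_prod_erase _ _ hj, ← mul_assoc, hsupp, Pi.one_apply, one_mul]

end PositiveSemidefinite

/-! ### Sum-of-squares relaxations and functions on the cube -/

section SumOfSquares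

open Finset MvPolynomial

variable {k n : ℕ}

/-- The polynomial `∏ i, (1 + y_i σ_i x_{j_i}) / 2` that indicates `C(x) = y` on the cube. -/
noncomputable def clauseIndicator (C : Clause k n) (y : Fin k → ℤˣ) (i : Fin k) :
    MvPolynomial (Fin n) ℝ :=
  MvPolynomial.C (1 / 2 : ℝ) *
    (1 + MvPolynomial.C (((y i * (C i).2 : ℤˣ) : ℤ) : ℝ) * X (C i).1)

theorem clausePoly_eq (f : (Fin k → ℤˣ) → ℝ) (C : Clause k n) :
    clausePoly f C = ∑ y, MvPolynomial.C (f y) * ∏ i, clauseIndicator C y i := rfl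

theorem totalDegree_clauseIndicator_le (C : Clause k n) (y : Fin k → ℤˣ) (i : Fin k) :
    (clauseIndicator C y i).totalDegree ≤ 1 := by
  refine (totalDegree_mul _ _).trans ?_
  rw [totalDegree_C, zero_add]
  refine (totalDegree_add _ _).trans (max_le (by simp) ((totalDegree_mul _ _).trans ?_))
  rw [totalDegree_C, totalDegree_X]

theorem totalDegree_prod_clauseIndicator_le (C : Clause k n) (y : Fin k → ℤˣ)
    (s : Finset (Fin k)) : (∏ i ∈ s, clauseIndicator C y i).totalDegree ≤ #s := by
  refine (totalDegree_finsetProd _ _).trans ?_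
  simpa using sum_le_sum fun i (_ : i ∈ s) => totalDegree_clauseIndicator_le C y i

theorem totalDegree_clausePoly_le (f : (Fin k → ℤˣ) → ℝ) (C : Clause k n) :
    (clausePoly f C).totalDegree ≤ k := by
  rw [clausePoly_eq]
  refine totalDegree_finsetSum_le fun y _ => (totalDegree_mul _ _).trans ?_
  rw [totalDegree_C, zero_add]
  exact (totalDegree_prod_clauseIndicator_le C y univ).trans (by simp)

theorem objectivePoly_mem_polyLE (P : (Fin k → ℤˣ) → Bool) (I : Finset (Clause k n)) {d : ℕ}
    (hd : k ≤ d) : objectivePoly P I ∈ polyLE n d := by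
  refine (mem_restrictTotalDegree _ _ _).2 ((totalDegree_mul _ _).trans ?_)
  rw [totalDegree_C, zero_add]
  exact totalDegree_finsetSum_le fun C _ => (totalDegree_clausePoly_le _ C).trans hd

theorem clauseIndicator_sq_sub (C : Clause k n) (y : Fin k → ℤˣ) (i : Fin k) :
    clauseIndicator C y i ^ 2 - clauseIndicator C y i
      = (X (C i).1 ^ 2 - 1) * MvPolynomial.C (1 / 4 : ℝ) := by
  have h1 : (MvPolynomial.C (((y i * (C i).2 : ℤˣ) : ℤ) : ℝ) : MvPolynomial (Fin n) ℝ) ^ 2 = 1 := by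
    rw [← map_pow, ← Int.cast_pow, ← Units.val_pow_eq_pow_val, Int.units_sq]
    simp
  have h2 : (MvPolynomial.C (1 / 2 : ℝ) : MvPolynomial (Fin n) ℝ) ^ 2
      = MvPolynomial.C (1 / 4 : ℝ) := by
    rw [← map_pow]; norm_num
  have h3 : (MvPolynomial.C (1 / 2 : ℝ) : MvPolynomial (Fin n) ℝ)
      = 2 * MvPolynomial.C (1 / 4 : ℝ) := by
    rw [← map_ofNat MvPolynomial.C, ← map_mul]; norm_num
  unfold clauseIndicator
  set s := (MvPolynomial.C (((y i * (C i).2 : ℤˣ) : ℤ) : ℝ) : MvPolynomial (Fin n) ℝ)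
  rw [mul_pow, h2, h3]
  linear_combination (MvPolynomial.C (1 / 4 : ℝ) * X (C i).1 ^ 2) * h1

theorem sum_prod_clauseIndicator (C : Clause k n) :
    ∑ y : Fin k → ℤˣ, ∏ i, clauseIndicator C y i = 1 := by
  have h : ∀ i, ∑ u : ℤˣ, MvPolynomial.C (1 / 2 : ℝ) *
      (1 + MvPolynomial.C (((u * (C i).2 : ℤˣ) : ℤ) : ℝ) * X (C i).1)
      = (1 : MvPolynomial (Fin n) ℝ) := by
    intro i
    have h3 : (MvPolynomial.C (1 / 2 : ℝ) : MvPolynomial (Fin n) ℝ) * 2 = 1 := by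
      rw [← map_ofNat MvPolynomial.C, ← map_mul]; norm_num
    rw [show (univ : Finset ℤˣ) = {1, -1} from rfl, sum_pair (by decide)]
    simp only [one_mul, neg_mul, Units.val_neg, Int.cast_neg, map_neg]
    linear_combination h3
  have h' := prod_univ_sum (fun _ : Fin k => (univ : Finset ℤˣ)) fun i u =>
    MvPolynomial.C (1 / 2 : ℝ) * (1 + MvPolynomial.C (((u * (C i).2 : ℤˣ) : ℤ) : ℝ) * X (C i).1)
  rw [prod_congr rfl fun i _ => h i, prod_const_one, Fintype.piFinset_univ] at h'
  exact h'.symm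

/-- A pseudo-expectation of sufficient degree is nonnegative on the indicators of the values of a
clause. -/
theorem IsPseudoExpectation.prod_clauseIndicator_nonneg {d : ℕ} {E : polyLE n d →ₗ[ℝ] ℝ}
    (hE : IsPseudoExpectation E)
    (hc : ∀ j : Fin n, SatisfiesConstraint E (X j ^ 2 - 1)) (hd : 2 * k ≤ d)
    {G : MvPolynomial (Fin n) ℝ →ₗ[ℝ] ℝ} (hG : ∀ p : polyLE n d, G p = E p) (C : Clause k n)
    (y : Fin k → ℤˣ) : 0 ≤ G (∏ i, clauseIndicator C y i) := by
  have hdeg1 := totalDegree_prod_clauseIndicator_le C y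
  -- The indicator is idempotent modulo `x_j² = 1`, so its pseudo-expectation is that of its square.
  -- Factors are duplicated one at a time, with degree at most `2 + 2(k - 1) = 2k ≤ d`.
  have hkey : ∀ s : Finset (Fin k),
      G ((∏ i, clauseIndicator C y i) * ∏ i ∈ s, clauseIndicator C y i)
        = G (∏ i, clauseIndicator C y i) := by
    intro s
    induction s using Finset.induction_on with
    | empty => simp
    | insert a s ha ih =>
      rw [← ih, ← sub_eq_zero, ← map_sub]
      set q := (∏ i ∈ univ.erase a, clauseIndicator C y i) * (∏ i ∈ s, clauseIndicator C y i) *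
        MvPolynomial.C (1 / 4 : ℝ)
      have hq : (∏ i, clauseIndicator C y i) * (∏ i ∈ insert a s, clauseIndicator C y i)
          - (∏ i, clauseIndicator C y i) * (∏ i ∈ s, clauseIndicator C y i)
          = (X (C a).1 ^ 2 - 1) * q := by
        rw [prod_insert ha, ← mul_prod_erase univ _ (mem_univ a)]
        linear_combination ((∏ i ∈ univ.erase a, clauseIndicator C y i) *
          (∏ i ∈ s, clauseIndicator C y i)) * clauseIndicator_sq_sub C y a
      have hX : (X (C a).1 ^ 2 - 1 : MvPolynomial (Fin n) ℝ).totalDegree ≤ 2 := by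
        refine (totalDegree_sub _ _).trans (max_le ?_ (by simp))
        exact (totalDegree_pow _ _).trans (by simp)
      have hqd : q.totalDegree ≤ (k - 1) + (k - 1) := by
        refine (totalDegree_mul _ _).trans ?_
        rw [totalDegree_C, add_zero]
        refine (totalDegree_mul _ _).trans (add_le_add ((hdeg1 _).trans ?_) ((hdeg1 _).trans ?_))
        · rw [card_erase_of_mem (mem_univ a), card_univ, Fintype.card_fin]
        · have := card_le_univ (insert a s)
          rw [card_insert_of_notMem ha, Fintype.card_fin] at this
          omega
      have hk := Fin.pos a
      have hle : (X (C a).1 ^ 2 - 1 : MvPolynomial (Fin n) ℝ).totalDegree + q.totalDegree ≤ d := by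
        omega
      rw [hq]
      exact (hG ⟨_, mul_mem_polyLE hle⟩).trans (hc (C a).1 q hle)
  rw [← hkey univ, ← sq]
  have h2 : 2 * (∏ i, clauseIndicator C y i).totalDegree ≤ d :=
    (Nat.mul_le_mul_left 2 ((hdeg1 univ).trans (by simp))).trans hd
  exact (hE.positivity _ h2).trans_eq (hG ⟨_, sq_mem_polyLE h2⟩).symm

theorem predValue_le_one (P : (Fin k → ℤˣ) → Bool) (y : Fin k → ℤˣ) : predValue P y ≤ 1 := by
  unfold predValue
  split_ifs <;> norm_num

/-- No feasible solution of the relaxation has objective value larger than `1`. -/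
theorem one_mem_upperBounds_sosObjectiveValues (P : (Fin k → ℤˣ) → Bool)
    (I : Finset (Clause k n)) {d : ℕ} (hd : 2 * k ≤ d) :
    1 ∈ upperBounds (sosObjectiveValues P I d) := by
  rintro v ⟨E, hE, hc, h, rfl⟩
  -- A linear extension to all polynomials removes the degree proofs from the algebra; its values in
  -- high degree play no role.
  obtain ⟨G, hG'⟩ := E.exists_extend
  have hG : ∀ p : polyLE n d, G p = E p := fun p => LinearMap.congr_fun hG' p
  have hclause : ∀ C : Clause k n, G (clausePoly (predValue P) C) ≤ 1 := by
    intro C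
    rw [clausePoly_eq, map_sum]
    calc _ ≤ ∑ y, G (∏ i, clauseIndicator C y i) := by
          refine sum_le_sum fun y _ => ?_
          rw [← smul_eq_C_mul, map_smul, smul_eq_mul]
          exact mul_le_of_le_one_left (hE.prod_clauseIndicator_nonneg hc hd hG C y)
            (predValue_le_one P y)
      _ = 1 := by
          rw [← map_sum, sum_prod_clauseIndicator]
          exact (hG ⟨1, one_mem_polyLE n d⟩).trans hE.normalization
  have hsum : ∑ C ∈ I, G (clausePoly (predValue P) C) ≤ #I := by
    simpa using sum_le_sum fun C (_ : C ∈ I) => hclause C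
  have hval : E ⟨objectivePoly P I, h⟩ = 1 / (#I : ℝ) * ∑ C ∈ I, G (clausePoly (predValue P) C) := by
    rw [← hG, ← map_sum, ← smul_eq_mul, ← map_smul, smul_eq_C_mul]
    rfl
  rw [hval, one_div_mul_eq_div]
  exact div_le_one_of_le₀ hsum (by positivity)

/-- The restriction of polynomials to the cube. -/
noncomputable def cubeEval (n : ℕ) : MvPolynomial (Fin n) ℝ →ₐ[ℝ] ((Fin n → ℤˣ) → ℝ) :=
  aeval fun j x => ((x j : ℤ) : ℝ)

theorem cubeEval_mem_iSup {d : ℕ} {p : MvPolynomial (Fin n) ℝ} (hp : p.totalDegree ≤ d) :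
    cubeEval n p ∈ ⨆ S ∈ {S : Finset (Fin n) | #S ≤ d}, dependsOnSubmodule S := by
  rw [p.as_sum, map_sum]
  refine Submodule.sum_mem _ fun s hs => ?_
  have hcard : #s.support ≤ d := by
    refine le_trans ?_ ((le_totalDegree hs).trans hp)
    rw [card_eq_sum_ones]
    exact sum_le_sum fun i hi => Nat.one_le_iff_ne_zero.2 (Finsupp.mem_support_iff.1 hi)
  refine Submodule.mem_iSup_of_mem s.support (Submodule.mem_iSup_of_mem hcard fun x y hxy => ?_)
  simp only [cubeEval, aeval_monomial, Finsupp.prod, Pi.mul_apply, prod_apply, Pi.pow_apply,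
    Pi.algebraMap_apply]
  congr 1
  exact prod_congr rfl fun i hi => by rw [hxy i hi]

theorem cubeEval_prod_clauseIndicator (C : Clause k n) (y : Fin k → ℤˣ) (x : Fin n → ℤˣ) :
    cubeEval n (∏ i, clauseIndicator C y i) x = if y = C.apply x then 1 else 0 := by
  have h1 : ∀ i, cubeEval n (clauseIndicator C y i) x
      = if y i = (C i).2 * x (C i).1 then 1 else 0 := by
    intro i
    simp only [clauseIndicator, cubeEval, map_mul, map_add, map_one, aeval_X, algHom_C,
      Pi.mul_apply, Pi.add_apply, Pi.one_apply, Pi.algebraMap_apply, Algebra.algebraMap_self,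
      RingHom.id_apply]
    rcases Int.units_eq_one_or (y i) with h | h <;>
      rcases Int.units_eq_one_or (C i).2 with h' | h' <;>
      rcases Int.units_eq_one_or (x (C i).1) with h'' | h'' <;> rw [h, h', h''] <;> norm_num
  rw [map_prod, prod_apply, prod_congr rfl fun i _ => h1 i, prod_boole]
  simp [_root_.funext_iff, Clause.apply]

theorem cubeEval_clausePoly (f : (Fin k → ℤˣ) → ℝ) (C : Clause k n) :
    cubeEval n (clausePoly f C) = fun x => f (C.apply x) := by
  ext x
  rw [clausePoly_eq, map_sum, Finset.sum_apply]
  have : ∀ y, cubeEval n (MvPolynomial.C (f y) * ∏ i, clauseIndicator C y i) x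
      = if y = C.apply x then f y else 0 := by
    intro y
    rw [← smul_eq_C_mul, map_smul, Pi.smul_apply, cubeEval_prod_clauseIndicator]
    simp
  simp [this]

/-- A functional on the functions on the cube that is positive in low degree and satisfies all
clauses is a solution of the relaxation of value `1`. -/
theorem one_mem_sosObjectiveValues (P : (Fin k → ℤˣ) → Bool) (I : Finset (Clause k n))
    (hI : I.Nonempty) {d : ℕ} (hd : k ≤ d) (Λ : ((Fin n → ℤˣ) → ℝ) →ₗ[ℝ] ℝ) (h1 : Λ 1 = 1)
    (hpos : ∀ p ∈ ⨆ S ∈ {S : Finset (Fin n) | #S ≤ d}, dependsOnSubmodule S, 0 ≤ Λ (p * p))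
    (hsat : ∀ C ∈ I, Λ (fun x => predValue P (C.apply x)) = 1) :
    1 ∈ sosObjectiveValues P I d := by
  refine ⟨(Λ.comp (cubeEval n).toLinearMap).comp (polyLE n d).subtype, ⟨?_, ?_⟩, ?_,
    objectivePoly_mem_polyLE P I hd, ?_⟩
  · simp [h1]
  · intro p hp
    have h := hpos (cubeEval n p) (cubeEval_mem_iSup (by omega))
    simpa [sq] using h
  · intro j q hq
    have : cubeEval n ((X j ^ 2 - 1) * q) = 0 := by
      ext x
      have hx : ((x j : ℤ) : ℝ) ^ 2 = 1 := by
        rw [← Int.cast_pow, ← Units.val_pow_eq_pow_val, Int.units_sq]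
        simp
      simp [cubeEval, hx]
    simp only [LinearMap.comp_apply, Submodule.subtype_apply, AlgHom.toLinearMap_apply, this,
      map_zero]
  · simp only [LinearMap.comp_apply, Submodule.subtype_apply, AlgHom.toLinearMap_apply]
    rw [objectivePoly, ← smul_eq_C_mul, map_smul, map_smul, map_sum, map_sum,
      sum_congr rfl fun C hC => (congrArg Λ (cubeEval_clausePoly _ C)).trans (hsat C hC)]
    have : (#I : ℝ) ≠ 0 := by exact_mod_cast hI.card_pos.ne'
    simp [this]

end SumOfSquares

/-! ### Random sparse hypergraphs by a first-moment count -/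

section SparseHypergraph

open Finset

theorem card_spanning_maps_le {k m N : ℕ} (A : Finset (Fin k × Fin N)) (R : Finset (Fin m)) :
    #(univ.filter fun π : Fin m → Fin k → Fin N => ∀ j ∈ R, ∀ i, (i, π j i) ∈ A)
      ≤ (#A ^ k) ^ #R * (N ^ k) ^ (m - #R) := by
  classical
  let T : Fin m → Finset (Fin k → Fin N) := fun j => Fintype.piFinset fun i =>
    if j ∈ R then univ.filter fun v => (i, v) ∈ A else univ
  have hsub : (univ.filter fun π : Fin m → Fin k → Fin N => ∀ j ∈ R, ∀ i, (i, π j i) ∈ A)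
      ⊆ Fintype.piFinset T := by
    intro π hπ
    simp only [mem_filter, mem_univ, true_and] at hπ
    simp only [T, Fintype.mem_piFinset]
    intro j i
    by_cases hj : j ∈ R
    · simp [hj, hπ j hj i]
    · simp [hj]
  have hT : ∀ j, #(T j) ≤ if j ∈ R then #A ^ k else N ^ k := by
    intro j
    rw [Fintype.card_piFinset]
    by_cases hj : j ∈ R
    · simp only [hj, if_true]
      calc _ ≤ ∏ _i : Fin k, #A := prod_le_prod' fun i _ =>
            card_le_card_of_injOn (fun v => (i, v)) (fun v hv => by simpa using hv)
              fun v _ v' _ h => (Prod.mk.inj h).2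
        _ = #A ^ k := by simp
    · simp [hj]
  refine (card_le_card hsub).trans ?_
  rw [Fintype.card_piFinset]
  refine (prod_le_prod' fun j _ => hT j).trans_eq ?_
  rw [prod_ite, prod_const, prod_const]
  congr 2
  · simp
  · rw [filter_not, filter_mem_eq_inter, univ_inter, card_sdiff_of_subset (subset_univ _)]
    simp

theorem pow_self_div_factorial_le (a : ℕ) : (a : ℝ) ^ a / (a.factorial : ℝ) ≤ Real.exp 1 ^ a := by
  refine (Real.pow_div_factorial_le_exp _ (Nat.cast_nonneg a) a).trans_eq ?_
  rw [← Real.exp_nat_mul, mul_one]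

theorem choose_mul_pow_le {K a : ℕ} {c t : ℝ} (ht : 0 ≤ t) (h : K * t ≤ c * a) :
    (K.choose a : ℝ) * t ^ a ≤ (c * Real.exp 1) ^ a := by
  rcases Nat.eq_zero_or_pos a with rfl | ha
  · simp
  have hc : 0 ≤ c := by
    have : (0 : ℝ) < a := by exact_mod_cast ha
    by_contra! hneg
    nlinarith [mul_nonneg (Nat.cast_nonneg (α := ℝ) K) ht]
  calc (K.choose a : ℝ) * t ^ a ≤ (K : ℝ) ^ a / (a.factorial : ℝ) * t ^ a := by
        gcongr
        exact Nat.choose_le_pow_div a K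
    _ = (K * t) ^ a / (a.factorial : ℝ) := by rw [mul_pow]; ring
    _ ≤ (c * a) ^ a / (a.factorial : ℝ) := by gcongr
    _ = c ^ a * ((a : ℝ) ^ a / (a.factorial : ℝ)) := by rw [mul_pow]; ring
    _ ≤ c ^ a * Real.exp 1 ^ a := by gcongr; exact pow_self_div_factorial_le a
    _ = _ := by rw [mul_pow]

/-- Write `kr = a + r + q` with `q ≥ r / 4`. Of the factors `a / N`, `a` absorb the choice of the
vertex set, `r` absorb the choice of the hyperedges, and the surplus `q` yields `y ^ r`. -/
theorem choose_mul_choose_mul_pow_le {k C N m a r : ℕ} {y : ℝ} (hk : 1 ≤ k) (hN : 0 < N)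
    (hm : m ≤ C * N) (har : 4 * a + 5 * r ≤ 4 * (k * r)) (hy0 : 0 ≤ y) (hy1 : y ≤ 1)
    (hay : (a : ℝ) / N ≤ y ^ 4) :
    ((k * N).choose a : ℝ) * (m.choose r : ℝ) * ((a : ℝ) / N) ^ (k * r)
      ≤ ((k * Real.exp 1) ^ k * (C * k * Real.exp 1) * y) ^ r := by
  have hN' : (0 : ℝ) < N := by exact_mod_cast hN
  set t : ℝ := (a : ℝ) / N with ht
  have ht0 : 0 ≤ t := by positivity
  obtain ⟨q, hq⟩ : ∃ q, k * r = a + r + q := ⟨k * r - a - r, by omega⟩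
  have hrq : r ≤ 4 * q := by omega
  have hk' : (1 : ℝ) ≤ k := by exact_mod_cast hk
  have he : (1 : ℝ) ≤ Real.exp 1 := Real.one_le_exp zero_le_one
  have h1 : ((k * N).choose a : ℝ) * t ^ a ≤ ((k * Real.exp 1) ^ k) ^ r := by
    refine (choose_mul_pow_le (c := k) ht0 ?_).trans ?_
    · rw [ht]; push_cast; field_simp; exact le_rfl
    · rw [← pow_mul]
      exact pow_le_pow_right₀ (one_le_mul_of_one_le_of_one_le hk' he) (by omega)
  have h2 : (m.choose r : ℝ) * t ^ r ≤ (C * k * Real.exp 1) ^ r := by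
    refine choose_mul_pow_le (c := C * k) ht0 ?_
    have h3 : (m : ℝ) ≤ C * N := by exact_mod_cast hm
    have h4 : (a : ℝ) ≤ k * r := by exact_mod_cast (by omega : a ≤ k * r)
    calc (m : ℝ) * t ≤ C * N * t := by gcongr
      _ = C * a := by rw [ht]; field_simp
      _ ≤ C * (k * r) := by gcongr
      _ = _ := by ring
  have h3 : t ^ q ≤ y ^ r := by
    calc t ^ q ≤ (y ^ 4) ^ q := by gcongr
      _ = y ^ (4 * q) := by rw [pow_mul]
      _ ≤ y ^ r := pow_le_pow_of_le_one hy0 hy1 hrq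
  calc _ = (((k * N).choose a : ℝ) * t ^ a) * ((m.choose r : ℝ) * t ^ r) * t ^ q := by
        rw [hq, pow_add, pow_add]; ring
    _ ≤ ((k * Real.exp 1) ^ k) ^ r * (C * k * Real.exp 1) ^ r * y ^ r := by gcongr
    _ = _ := by simp only [mul_pow]

theorem sum_one_third_pow_lt_one (K : ℕ) : ∑ a ∈ range K, (1 / 3 : ℝ) ^ (a + 1) < 1 := by
  have h : ∀ K : ℕ, ∑ a ∈ range K, (1 / 3 : ℝ) ^ (a + 1) = (1 - (1 / 3) ^ K) / 2 := by
    intro K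
    induction K with
    | zero => simp
    | succ K ih => rw [sum_range_succ, ih]; ring
  rw [h]
  have : (0 : ℝ) < (1 / 3) ^ K := by positivity
  linarith

/-- For every density there are `k`-partite `k`-uniform hypergraphs on `k * N` vertices in which
every set `A` of at most a constant fraction of the vertices spans at most `|A| / (k - 5/4)`
hyperedges. -/
theorem exists_sparse_partite_hypergraph (k C : ℕ) (hk : 2 ≤ k) :
    ∃ γ : ℝ, 0 < γ ∧ ∀ N m : ℕ, 0 < N → m ≤ C * N → ∃ π : Fin m → Fin k → Fin N,
      ∀ A : Finset (Fin k × Fin N), (#A : ℝ) ≤ γ * N →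
        (4 * k - 5) * #(spanned (fun j i => (i, π j i)) A) ≤ 4 * #A := by
  set B : ℝ := (k * Real.exp 1) ^ k * (C * k * Real.exp 1) with hB
  have hB0 : 0 ≤ B := by positivity
  -- Chosen so that `B * y ≤ 3⁻ᵏ`: then bad vertex sets of size `a` contribute at most `3⁻ᵃ` in
  -- total, and these bounds sum to less than one.
  set y : ℝ := 1 / (3 ^ k * (B + 1)) with hy
  have hy0 : 0 < y := by positivity
  have hBy : B * y ≤ (1 / 3) ^ k := by
    rw [hy, one_div_pow, mul_one_div, div_le_div_iff₀ (by positivity) (by positivity)]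
    nlinarith [pow_pos (by norm_num : (0 : ℝ) < 3) k]
  have hy1 : y ≤ 1 := by
    rw [hy, div_le_one (by positivity)]
    exact one_le_mul_of_one_le_of_one_le (one_le_pow₀ (by norm_num)) (by linarith)
  refine ⟨y ^ 4, by positivity, fun N m hN hm => ?_⟩
  by_contra! hcon
  have hN' : (0 : ℝ) < N := by exact_mod_cast hN
  -- The least number of spanned hyperedges that violates sparsity for a set of `a` vertices.
  let r : ℕ → ℕ := fun a => 4 * a / (4 * k - 5) + 1
  have hr : ∀ a, 4 * a < (4 * k - 5) * r a := fun a => Nat.lt_mul_div_succ _ (by omega)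
  let K := ⌊y ^ 4 * N⌋₊
  let bad : Finset (Fin k × Fin N) → Finset (Fin m) → Finset (Fin m → Fin k → Fin N) :=
    fun A R => univ.filter fun π => ∀ j ∈ R, ∀ i, (i, π j i) ∈ A
  have hcover : (univ : Finset (Fin m → Fin k → Fin N)) ⊆ (range K).biUnion fun a =>
      (powersetCard (a + 1) univ).biUnion fun A => (powersetCard (r (a + 1)) univ).biUnion
        fun R => bad A R := by
    intro π _
    obtain ⟨A, hA, hlt⟩ := hcon π
    have hA0 : 0 < #A := by
      rw [card_pos, nonempty_iff_ne_empty]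
      rintro rfl
      rw [spanned_empty _ (by omega)] at hlt
      simp at hlt
    have hrle : r #A ≤ #(spanned (fun j i => (i, π j i)) A) :=
      Nat.succ_le_of_lt (Nat.div_lt_of_lt_mul hlt)
    obtain ⟨R, hR, hRc⟩ := exists_subset_card_eq hrle
    simp only [mem_biUnion, mem_range, mem_powersetCard, subset_univ, true_and]
    refine ⟨#A - 1, ?_, A, by omega, R, ?_, ?_⟩
    · have := Nat.le_floor hA
      omega
    · rw [hRc, Nat.sub_add_cancel hA0]
    · simp only [bad, mem_filter, mem_univ, true_and]
      exact fun j hj => mem_spanned.1 (hR hj)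
  have hbad : ∀ A R, (#(bad A R) : ℝ)
      ≤ ((#A : ℝ) / N) ^ (k * #R) * ((N : ℝ) ^ k) ^ m := by
    intro A R
    have h1 : (#(bad A R) : ℝ) ≤ ((#A : ℝ) ^ k) ^ #R * ((N : ℝ) ^ k) ^ (m - #R) := by
      exact_mod_cast card_spanning_maps_le A R
    refine h1.trans_eq ?_
    have h2 : #R + (m - #R) = m := by
      have := card_le_univ R
      rw [Fintype.card_fin] at this
      omega
    have h3 : ((N : ℝ) ^ k) ^ m = ((N : ℝ) ^ k) ^ #R * ((N : ℝ) ^ k) ^ (m - #R) := by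
      rw [← pow_add, h2]
    rw [h3, div_pow, pow_mul, pow_mul]
    field_simp
  have htotal : ((N : ℝ) ^ k) ^ m
      ≤ ∑ a ∈ range K, (1 / 3 : ℝ) ^ (a + 1) * ((N : ℝ) ^ k) ^ m := by
    have h1 : ((N : ℝ) ^ k) ^ m = (#(univ : Finset (Fin m → Fin k → Fin N)) : ℝ) := by
      simp [card_univ]
    have h2 : #(univ : Finset (Fin m → Fin k → Fin N)) ≤ ∑ a ∈ range K,
        ∑ A ∈ powersetCard (a + 1) univ, ∑ R ∈ powersetCard (r (a + 1)) univ, #(bad A R) := by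
      refine (card_le_card hcover).trans (card_biUnion_le.trans (sum_le_sum fun a _ => ?_))
      exact card_biUnion_le.trans (sum_le_sum fun A _ => card_biUnion_le)
    rw [h1]
    refine (Nat.cast_le.2 h2).trans ?_
    rw [← h1]
    push_cast
    refine sum_le_sum fun a ha => ?_
    have hsum : ∑ A ∈ powersetCard (a + 1) (univ : Finset (Fin k × Fin N)),
        ∑ R ∈ powersetCard (r (a + 1)) (univ : Finset (Fin m)), (#(bad A R) : ℝ)
        ≤ ∑ A ∈ powersetCard (a + 1) (univ : Finset (Fin k × Fin N)),
          ∑ R ∈ powersetCard (r (a + 1)) (univ : Finset (Fin m)),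
            ((((a + 1 : ℕ) : ℝ) / N) ^ (k * r (a + 1)) * ((N : ℝ) ^ k) ^ m) := by
      refine sum_le_sum fun A hA => sum_le_sum fun R hR => ?_
      have := hbad A R
      rwa [(mem_powersetCard.1 hA).2, (mem_powersetCard.1 hR).2] at this
    refine hsum.trans ?_
    simp only [sum_const, card_powersetCard, card_univ, Fintype.card_prod, Fintype.card_fin,
      nsmul_eq_mul]
    rw [← mul_assoc, ← mul_assoc]
    refine mul_le_mul_of_nonneg_right ?_ (by positivity)
    have hra := hr (a + 1)
    have har : 4 * (a + 1) + 5 * r (a + 1) ≤ 4 * (k * r (a + 1)) := by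
      have : 4 * (k * r (a + 1)) = (4 * k - 5) * r (a + 1) + 5 * r (a + 1) := by
        rw [← add_mul, Nat.sub_add_cancel (by omega), mul_assoc]
      omega
    have hay : ((a + 1 : ℕ) : ℝ) / N ≤ y ^ 4 := by
      rw [div_le_iff₀ hN']
      exact (Nat.cast_le.2 (Nat.succ_le_of_lt (mem_range.1 ha))).trans
        (Nat.floor_le (by positivity))
    refine (choose_mul_choose_mul_pow_le (by omega) hN hm har hy0.le hy1 hay).trans ?_
    calc (B * y) ^ r (a + 1) ≤ ((1 / 3) ^ k) ^ r (a + 1) := by gcongr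
      _ = (1 / 3) ^ (k * r (a + 1)) := by rw [pow_mul]
      _ ≤ (1 / 3) ^ (a + 1) :=
          pow_le_pow_of_le_one (by norm_num) (by norm_num) (by omega)
  rw [← sum_mul] at htotal
  have hpos : (0 : ℝ) < ((N : ℝ) ^ k) ^ m := by positivity
  nlinarith [sum_one_third_pow_lt_one K]

end SparseHypergraph

/-! ### Soundness from random signs -/

section RandomSigns

open Finset

variable {k : ℕ}

/-- The probability that a uniformly random point satisfies `P`. -/
noncomputable def density (P : (Fin k → ℤˣ) → Bool) : ℝ :=
  (Fintype.card {y : Fin k → ℤˣ // P y = true} : ℝ) / 2 ^ k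

theorem sum_predValue (P : (Fin k → ℤˣ) → Bool) : ∑ y, predValue P y = density P * 2 ^ k := by
  rw [density, div_mul_cancel₀ _ (by positivity), Fintype.card_subtype]
  simp [predValue]

theorem predValue_nonneg (P : (Fin k → ℤˣ) → Bool) (y : Fin k → ℤˣ) : 0 ≤ predValue P y := by
  unfold predValue
  split_ifs <;> norm_num

theorem density_nonneg (P : (Fin k → ℤˣ) → Bool) : 0 ≤ density P := by
  unfold density
  positivity

theorem card_signs (k : ℕ) : Fintype.card (Fin k → ℤˣ) = 2 ^ k := by
  simp

theorem density_le_one (P : (Fin k → ℤˣ) → Bool) : density P ≤ 1 := by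
  refine div_le_one_of_le₀ ?_ (by positivity)
  exact_mod_cast (Fintype.card_subtype_le _).trans_eq (card_signs k)

/-- In `exp s ≤ 1 + s + s²` for `|s| ≤ 1` the linear term averages to zero, and `2t ≤ ε` gives `t² -
tε ≤ -t²`. -/
theorem sum_exp_le (P : (Fin k → ℤˣ) → Bool) {t ε : ℝ} (ht0 : 0 ≤ t) (ht1 : t ≤ 1)
    (htε : 2 * t ≤ ε) :
    ∑ y, Real.exp (t * (predValue P y - density P - ε)) ≤ 2 ^ k * Real.exp (-t ^ 2) := by
  have h1 : ∀ y, Real.exp (t * (predValue P y - density P))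
      ≤ 1 + t * (predValue P y - density P) + t ^ 2 := by
    intro y
    have hy : |predValue P y - density P| ≤ 1 := by
      rw [abs_le]
      constructor <;> linarith [predValue_nonneg P y, predValue_le_one P y, density_nonneg P,
        density_le_one P]
    have hty : |t * (predValue P y - density P)| ≤ 1 := by
      rw [abs_mul, abs_of_nonneg ht0]
      exact mul_le_one₀ ht1 (abs_nonneg _) hy
    have h2 := (abs_le.1 (Real.abs_exp_sub_one_sub_id_le hty)).2
    have h3 : (t * (predValue P y - density P)) ^ 2 ≤ t ^ 2 := by
      rw [mul_pow]
      exact mul_le_of_le_one_right (sq_nonneg t) ((sq_le_one_iff_abs_le_one _).2 hy)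
    linarith
  have h2 : ∑ y, Real.exp (t * (predValue P y - density P)) ≤ 2 ^ k * Real.exp (t ^ 2) := by
    calc _ ≤ ∑ y, (1 + t * (predValue P y - density P) + t ^ 2) := sum_le_sum fun y _ => h1 y
      _ = 2 ^ k * (1 + t ^ 2) := by
          simp only [sum_add_distrib, ← mul_sum, sum_sub_distrib, sum_const, card_univ,
            card_signs, nsmul_eq_mul, sum_predValue]
          push_cast
          ring
      _ ≤ _ := by
          gcongr
          linarith [Real.add_one_le_exp (t ^ 2)]
  calc _ = (∑ y, Real.exp (t * (predValue P y - density P))) * Real.exp (-(t * ε)) := by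
        rw [sum_mul]
        refine sum_congr rfl fun y _ => ?_
        rw [← Real.exp_add]
        ring_nf
    _ ≤ 2 ^ k * Real.exp (t ^ 2) * Real.exp (-(t * ε)) := by gcongr
    _ = 2 ^ k * Real.exp (t ^ 2 - t * ε) := by rw [mul_assoc, ← Real.exp_add, sub_eq_add_neg]
    _ ≤ _ := by
        gcongr
        nlinarith

/-- For some choice of signs of the literals no assignment satisfies much more than the expected
fraction of the clauses. -/
theorem exists_signs_sum_predValue_le (P : (Fin k → ℤˣ) → Bool) {n m : ℕ}
    (e : Fin m → Fin k → Fin n) {t ε : ℝ} (ht0 : 0 < t) (ht1 : t ≤ 1) (htε : 2 * t ≤ ε)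
    (hn : 0 < n) (hnm : n ≤ t ^ 2 * m) :
    ∃ σ : Fin m → Fin k → ℤˣ, ∀ x : Fin n → ℤˣ,
      ∑ j, predValue P (fun i => σ j i * x (e j i)) ≤ (density P + ε) * m := by
  let φ : (Fin k → ℤˣ) → ℝ := fun y => Real.exp (t * (predValue P y - density P - ε))
  -- For fixed `x`, multiplication by `x` permutes the signs, so the sum over `σ` factors over the
  -- clauses independently of `x`.
  have hswap : ∑ σ : Fin m → Fin k → ℤˣ, ∑ x : Fin n → ℤˣ,
      ∏ j, φ (fun i => σ j i * x (e j i)) = 2 ^ n * (∑ y, φ y) ^ m := by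
    rw [sum_comm]
    have h1 : ∀ x : Fin n → ℤˣ, ∑ σ : Fin m → Fin k → ℤˣ, ∏ j, φ (fun i => σ j i * x (e j i))
        = (∑ y, φ y) ^ m := by
      intro x
      have h2 := prod_univ_sum (fun _ : Fin m => (univ : Finset (Fin k → ℤˣ)))
        fun j τ => φ fun i => τ i * x (e j i)
      rw [Fintype.piFinset_univ] at h2
      rw [← h2]
      have h3 : ∀ j, ∑ τ : Fin k → ℤˣ, φ (fun i => τ i * x (e j i)) = ∑ y, φ y := fun j =>
        Fintype.sum_equiv (Equiv.mulRight fun i => x (e j i)) _ _ fun _ => rfl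
      rw [prod_congr rfl fun j _ => h3 j]
      simp
    rw [sum_congr rfl fun x _ => h1 x]
    simp
  have hlt : ∑ σ : Fin m → Fin k → ℤˣ, ∑ x : Fin n → ℤˣ, ∏ j, φ (fun i => σ j i * x (e j i))
      < ∑ _σ : Fin m → Fin k → ℤˣ, (1 : ℝ) := by
    rw [hswap]
    have hφ : (∑ y, φ y) ^ m ≤ (2 ^ k * Real.exp (-t ^ 2)) ^ m :=
      pow_le_pow_left₀ (sum_nonneg fun y _ => (Real.exp_pos _).le)
        (sum_exp_le P ht0.le ht1 htε) m
    have h2 : (2 : ℝ) ^ n * Real.exp (-t ^ 2) ^ m < 1 := by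
      have h3 : (2 : ℝ) ^ n < Real.exp 1 ^ n :=
        pow_lt_pow_left₀ (by linarith [Real.exp_one_gt_d9]) (by norm_num) hn.ne'
      have h4 : Real.exp (-t ^ 2) ^ m ≤ Real.exp (-n) := by
        rw [← Real.exp_nat_mul]
        exact Real.exp_le_exp.2 (by nlinarith)
      calc (2 : ℝ) ^ n * Real.exp (-t ^ 2) ^ m ≤ 2 ^ n * Real.exp (-n) := by gcongr
        _ < Real.exp 1 ^ n * Real.exp (-n) := by gcongr
        _ = 1 := by rw [← Real.exp_nat_mul, ← Real.exp_add]; simp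
    calc 2 ^ n * (∑ y, φ y) ^ m ≤ 2 ^ n * (2 ^ k * Real.exp (-t ^ 2)) ^ m := by gcongr
      _ = (2 ^ n * Real.exp (-t ^ 2) ^ m) * (2 ^ k) ^ m := by rw [mul_pow]; ring
      _ < 1 * (2 ^ k) ^ m := by gcongr
      _ = _ := by simp
  obtain ⟨σ, -, hσ⟩ := exists_lt_of_sum_lt hlt
  refine ⟨σ, fun x => ?_⟩
  -- The terms are nonnegative and sum to less than one, so each is less than one: this is the union
  -- bound over all `x`.
  have h1 : ∏ j, φ (fun i => σ j i * x (e j i)) < 1 := lt_of_le_of_lt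
    (single_le_sum (f := fun x : Fin n → ℤˣ => ∏ j, φ (fun i => σ j i * x (e j i)))
      (fun x _ => prod_nonneg fun j _ => (Real.exp_pos _).le) (mem_univ x)) hσ
  rw [← Real.exp_sum, Real.exp_lt_one_iff, ← mul_sum] at h1
  have h2 := neg_of_mul_neg_right h1 ht0.le
  simp only [sum_sub_distrib, sum_const, card_univ, Fintype.card_fin, nsmul_eq_mul] at h2
  linarith

end RandomSigns

/-! ### Fourier expansion of pairwise independent distributions -/

section PairwiseIndependence

open Finset

variable {k : ℕ}

/-- A predicate in at most two variables that supports a pairwise independent distribution is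
always true. -/
theorem IsPairwiseIndependent.forall_eq_true {μ : PMF (Fin k → ℤˣ)}
    (hμ : IsPairwiseIndependent μ) (hk : k ≤ 2) {P : (Fin k → ℤˣ) → Bool}
    (hP : ∀ y ∈ μ.support, P y = true) (y : Fin k → ℤˣ) : P y = true := by
  interval_cases k
  · obtain ⟨z, hz⟩ := μ.support_nonempty
    rw [Subsingleton.elim y z]
    exact hP z hz
  · have h : y 0 ∈ (μ.map fun y => y 0).support := by
      rw [hμ.single 0]
      exact PMF.mem_support_uniformOfFintype _
    obtain ⟨z, hz, hzy⟩ := (PMF.mem_support_map_iff _ _ _).1 h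
    have : z = y := by
      ext i
      rw [Subsingleton.elim i 0, hzy]
    exact hP y (this ▸ hz)
  · have h : (y 0, y 1) ∈ (μ.map fun y => (y 0, y 1)).support := by
      rw [hμ.pair 0 1 (by decide)]
      exact PMF.mem_support_uniformOfFintype _
    obtain ⟨z, hz, hzy⟩ := (PMF.mem_support_map_iff _ _ _).1 h
    have : z = y := by
      ext i
      rw [Prod.mk.injEq] at hzy
      fin_cases i
      · exact congrArg _ hzy.1
      · exact congrArg _ hzy.2
    exact hP y (this ▸ hz)

theorem sum_toReal_mul_comp {Y Z : Type*} [Fintype Y] [Fintype Z] (μ : PMF Y)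
    (f : Y → Z) (g : Z → ℝ) :
    ∑ y, (μ y).toReal * g (f y) = ∑ z, (μ.map f z).toReal * g z := by
  classical
  have h1 : ∀ z, (μ.map f z).toReal = ∑ y, if z = f y then (μ y).toReal else 0 := by
    intro z
    rw [PMF.map_apply, tsum_fintype, ENNReal.toReal_sum]
    · exact sum_congr rfl fun y _ => by split_ifs <;> rfl
    · intro y _
      split_ifs
      · exact μ.apply_ne_top y
      · simp
  simp_rw [h1, sum_mul]
  rw [sum_comm]
  refine sum_congr rfl fun y _ => ?_
  simp [ite_mul]

/-- The Fourier coefficients of a distribution on the cube. -/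
noncomputable def cubeFourierCoeff (μ : PMF (Fin k → ℤˣ)) (S : Finset (Fin k)) : ℝ :=
  ∑ z, (μ z).toReal * ∏ i ∈ S, ((z i : ℤ) : ℝ)

theorem sum_toReal_pmf {Y : Type*} [Fintype Y] (μ : PMF Y) : ∑ y, (μ y).toReal = 1 := by
  rw [← ENNReal.toReal_sum fun y _ => μ.apply_ne_top y, ← tsum_fintype (L := .unconditional _),
    μ.tsum_coe]
  rfl

theorem cubeFourierCoeff_empty (μ : PMF (Fin k → ℤˣ)) : cubeFourierCoeff μ ∅ = 1 := by
  simp [cubeFourierCoeff, sum_toReal_pmf]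

theorem IsPairwiseIndependent.cubeFourierCoeff_eq_zero {μ : PMF (Fin k → ℤˣ)}
    (hμ : IsPairwiseIndependent μ) {S : Finset (Fin k)} (hS : S ≠ ∅) (hS3 : #S < 3) :
    cubeFourierCoeff μ S = 0 := by
  have hS0 : 0 < #S := card_pos.2 (nonempty_iff_ne_empty.2 hS)
  have huniv : (univ : Finset ℤˣ) = {1, -1} := rfl
  obtain h | h : #S = 1 ∨ #S = 2 := by omega
  · obtain ⟨a, rfl⟩ := card_eq_one.1 h
    simp only [cubeFourierCoeff, prod_singleton]
    rw [sum_toReal_mul_comp μ (fun y => y a) fun u => ((u : ℤ) : ℝ), hμ.single a, huniv,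
      sum_pair (by decide)]
    simp
  · obtain ⟨a, b, hab, rfl⟩ := card_eq_two.1 h
    simp only [cubeFourierCoeff, prod_pair hab]
    rw [sum_toReal_mul_comp μ (fun y => (y a, y b)) fun u => ((u.1 : ℤ) : ℝ) * ((u.2 : ℤ) : ℝ),
      hμ.pair a b hab, Fintype.sum_prod_type, huniv, sum_pair (by decide), sum_pair (by decide),
      sum_pair (by decide)]
    simp

/-- Fourier inversion: the sum over `S` of the products of characters is `∏ i, (1 + z_i y_i)`, which
is `2 ^ k` if `z = y` and zero otherwise. -/
theorem two_pow_mul_toReal_eq_sum (μ : PMF (Fin k → ℤˣ)) (y : Fin k → ℤˣ) :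
    2 ^ k * (μ y).toReal = ∑ S : Finset (Fin k), cubeFourierCoeff μ S * ∏ i ∈ S, ((y i : ℤ) : ℝ) := by
  have h1 : ∀ z : Fin k → ℤˣ, ∑ S : Finset (Fin k), (∏ i ∈ S, ((z i : ℤ) : ℝ)) *
      ∏ i ∈ S, ((y i : ℤ) : ℝ) = if z = y then 2 ^ k else 0 := by
    intro z
    have h2 : ∀ i, 1 + ((z i : ℤ) : ℝ) * ((y i : ℤ) : ℝ) = if z i = y i then 2 else 0 := by
      intro i
      rcases Int.units_eq_one_or (y i) with h | h <;>
        rcases Int.units_eq_one_or (z i) with h' | h' <;> rw [h, h'] <;> norm_num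
    simp_rw [← prod_mul_distrib]
    rw [← powerset_univ, ← prod_one_add, prod_congr rfl fun i _ => h2 i, prod_ite_zero]
    simp [funext_iff]
  simp_rw [cubeFourierCoeff, sum_mul]
  rw [sum_comm]
  simp_rw [mul_assoc, ← mul_sum, h1]
  simp [mul_comm]

theorem IsPairwiseIndependent.two_pow_mul_sub_one {μ : PMF (Fin k → ℤˣ)}
    (hμ : IsPairwiseIndependent μ) (y : Fin k → ℤˣ) :
    2 ^ k * (μ y).toReal - 1 = ∑ S : {S : Finset (Fin k) // 3 ≤ #S},
      cubeFourierCoeff μ S * ∏ i ∈ S.1, ((y i : ℤ) : ℝ) := by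
  rw [two_pow_mul_toReal_eq_sum, ← add_sum_erase _ _ (mem_univ (∅ : Finset (Fin k))),
    cubeFourierCoeff_empty, prod_empty, mul_one, add_sub_cancel_left,
    ← sum_subtype (univ.filter fun S : Finset (Fin k) => 3 ≤ #S) (by simp)
      fun S => cubeFourierCoeff μ S * ∏ i ∈ S, ((y i : ℤ) : ℝ)]
  symm
  refine sum_subset (fun S hS => ?_) fun S hS hS3 => ?_
  · refine mem_erase.2 ⟨?_, mem_univ _⟩
    rintro rfl
    simp at hS
  · rw [hμ.cubeFourierCoeff_eq_zero (mem_erase.1 hS).1 (by simpa using hS3), zero_mul]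

end PairwiseIndependence

/-! ### The instances and their relaxation value -/

section Instances

open Finset

variable {k n : ℕ}

theorem hasSOSValue_one_of_forall_eq_true {P : (Fin k → ℤˣ) → Bool} (hP : ∀ y, P y = true)
    {I : Finset (Clause k n)} (hI : I.Nonempty) {d : ℕ} (hd : 2 * k ≤ d) :
    HasSOSValue P I d 1 := by
  refine ⟨one_mem_sosObjectiveValues P I hI (by omega) (LinearMap.proj fun _ => 1) rfl
    (fun p _ => mul_self_nonneg _) fun C _ => ?_, one_mem_upperBounds_sosObjectiveValues P I hd⟩
  simp [predValue, hP]

theorem satFraction_le_one (P : (Fin k → ℤˣ) → Bool) (I : Finset (Clause k n))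
    (x : Fin n → ℤˣ) : satFraction P I x ≤ 1 := by
  refine div_le_one_of_le₀ ?_ (by positivity)
  simpa using sum_le_sum fun C (_ : C ∈ I) => predValue_le_one P (C.apply x)

/-- The clause with variables `e j` and signs `σ j`. -/
def signedClause {J : Type*} (e : J → Fin k → Fin n) (σ : J → Fin k → ℤˣ) (j : J) : Clause k n :=
  fun i => (e j i, σ j i)

theorem apply_signedClause {J : Type*} (e : J → Fin k → Fin n) (σ : J → Fin k → ℤˣ) (j : J)
    (x : Fin n → ℤˣ) : (signedClause e σ j).apply x = fun i => σ j i * x (e j i) := rfl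

/-- Two hyperedges on the same `k` vertices would give `2(4k - 5) ≤ 4k`, which fails for `k ≥ 3`.
Injectivity keeps the set of clauses as large as the indexed family for which the signs were chosen.
-/
theorem SparseUpTo.signedClause_injective {J : Type*} [Fintype J] {e : J → Fin k → Fin n} {M : ℕ}
    (he : SparseUpTo e M) (hk : 3 ≤ k) (hkM : k ≤ M) (σ : J → Fin k → ℤˣ) :
    Function.Injective (signedClause e σ) := by
  classical
  intro j j' h
  by_contra hne
  have hee : ∀ i, e j i = e j' i := fun i => congrArg Prod.fst (congrFun h i)
  have hcard : #(univ.image (e j)) ≤ k := card_image_le.trans (by simp)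
  have h1 := he _ (hcard.trans hkM)
  have h2 : ({j, j'} : Finset J) ⊆ spanned e (univ.image (e j)) := by
    intro l hl
    rw [mem_insert, mem_singleton] at hl
    rcases hl with rfl | rfl
    · exact mem_spanned.2 fun i => mem_image_of_mem _ (mem_univ i)
    · exact mem_spanned.2 fun i => by rw [← hee i]; exact mem_image_of_mem _ (mem_univ i)
  have h3 := card_le_card h2
  rw [card_pair hne] at h3
  zify at hcard h3 hk
  nlinarith

/-- The local density of a signed clause minus one. -/
noncomputable def clauseDensity {J : Type*} (μ : PMF (Fin k → ℤˣ)) (e : J → Fin k → Fin n)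
    (σ : J → Fin k → ℤˣ) (j : J) (x : Fin n → ℤˣ) : ℝ :=
  2 ^ k * (μ ((signedClause e σ j).apply x)).toReal - 1

theorem IsPairwiseIndependent.hasHighFourierSupport {J : Type*} {μ : PMF (Fin k → ℤˣ)}
    (hμ : IsPairwiseIndependent μ) (e : J → Fin k → Fin n) (σ : J → Fin k → ℤˣ) :
    HasHighFourierSupport e (clauseDensity μ e σ) := by
  refine ⟨fun j S => cubeFourierCoeff μ S * ∏ i ∈ S, ((σ j i : ℤ) : ℝ), fun j x => ?_⟩
  rw [clauseDensity, hμ.two_pow_mul_sub_one]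
  refine sum_congr rfl fun S _ => ?_
  simp [apply_signedClause, prod_mul_distrib, mul_assoc]

/-- The instances on sparse hypergraphs have a solution of the relaxation that satisfies all
clauses. -/
theorem hasSOSValue_one_of_sparse {J : Type*} [Fintype J] [DecidableEq J]
    {P : (Fin k → ℤˣ) → Bool} {μ : PMF (Fin k → ℤˣ)} (hμ : IsPairwiseIndependent μ)
    (hP : ∀ y ∈ μ.support, P y = true) (hk : 2 ≤ k) {e : J → Fin k → Fin n} {M d : ℕ}
    (he : SparseUpTo e M) (hM : 12 * k * d ≤ M) (hd : 2 * k ≤ d) (σ : J → Fin k → ℤˣ)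
    (hI : (univ.image (signedClause e σ)).Nonempty) :
    HasSOSValue P (univ.image (signedClause e σ)) d 1 := by
  have hν := hμ.hasHighFourierSupport e σ
  refine ⟨one_mem_sosObjectiveValues P _ hI (by omega)
    (pseudoFunctional (clauseDensity μ e σ) (8 * d)) (pseudoFunctional_one hν hk he hM)
    (fun p hp => pseudoFunctional_mul_self_nonneg hν (fun j x => ?_) hk he hM hp)
    fun C hC => ?_, one_mem_upperBounds_sosObjectiveValues P _ hd⟩
  · rw [clauseDensity, add_sub_cancel]
    positivity
  · obtain ⟨j, -, rfl⟩ := mem_image.1 hC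
    refine pseudoFunctional_eq_one hν hk he hM (by omega) (j := j) (fun x y hxy => ?_) fun x => ?_
    · refine congrArg (predValue P) (funext fun i => ?_)
      simp only [apply_signedClause]
      rw [hxy _ (mem_coe.2 (mem_image_of_mem _ (mem_univ i)))]
    · rw [clauseDensity, add_sub_cancel]
      by_cases h : μ ((signedClause e σ j).apply x) = 0
      · simp [h]
      · simp [predValue, hP _ ((PMF.mem_support_iff _ _).2 h)]

theorem satFraction_image_signedClause_le {m : ℕ} (hm : 0 < m) {P : (Fin k → ℤˣ) → Bool}
    {e : Fin m → Fin k → Fin n} {σ : Fin m → Fin k → ℤˣ}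
    (hinj : Function.Injective (signedClause e σ)) {x : Fin n → ℤˣ} {c : ℝ}
    (h : ∑ j, predValue P (fun i => σ j i * x (e j i)) ≤ c * m) :
    satFraction P (univ.image (signedClause e σ)) x ≤ c := by
  have hm' : (0 : ℝ) < m := by exact_mod_cast hm
  rw [satFraction, sum_image hinj.injOn, card_image_of_injective _ hinj, card_univ,
    Fintype.card_fin, div_le_iff₀ hm']
  exact h

/-- Sparse `k`-uniform hypergraphs with `C * n` hyperedges on `n` vertices. -/
theorem exists_sparse_hypergraph (k C : ℕ) (hk : 2 ≤ k) :
    ∃ γ : ℝ, 0 < γ ∧ ∀ n M : ℕ, k ≤ n → (M : ℝ) ≤ γ * n →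
      ∃ e : Fin (C * n) → Fin k → Fin n, (∀ j, Function.Injective (e j)) ∧ SparseUpTo e M := by
  obtain ⟨γ, hγ, h⟩ := exists_sparse_partite_hypergraph k (2 * k * C) hk
  have hk0 : (0 : ℝ) < k := by exact_mod_cast (by omega : 0 < k)
  refine ⟨γ / (2 * k), by positivity, fun n M hkn hM => ?_⟩
  have hN : 0 < n / k := Nat.div_pos hkn (by omega)
  -- Rounding `n` down to a multiple of `k` loses at most a factor two; hence the density `2 * k *
  -- C` and the constant `γ / (2 * k)`.
  have hn : n ≤ 2 * k * (n / k) := by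
    have := Nat.div_add_mod n k
    have := Nat.mod_lt n (by omega : 0 < k)
    nlinarith
  obtain ⟨π, hπ⟩ := h (n / k) (C * n) hN (by nlinarith [Nat.mul_le_mul_left C hn])
  obtain ⟨ι⟩ : Nonempty (Fin k × Fin (n / k) ↪ Fin n) :=
    Function.Embedding.nonempty_of_card_le (by simpa using Nat.mul_div_le n k)
  refine ⟨fun j i => ι (i, π j i), fun j i i' hi => (Prod.mk.inj (ι.injective hi)).1,
    fun A hA => ?_⟩
  let A' : Finset (Fin k × Fin (n / k)) := univ.filter fun p => ι p ∈ A
  have hA' : #A' ≤ #A := card_le_card_of_injOn ι (fun p hp => by simpa [A'] using hp)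
    ι.injective.injOn
  have hspan : spanned (fun j i => (i, π j i)) A' = spanned (fun j i => ι (i, π j i)) A := by
    ext j
    simp [mem_spanned, A']
  have h1 := hπ A' (by
    calc (#A' : ℝ) ≤ M := by exact_mod_cast hA'.trans hA
      _ ≤ γ / (2 * k) * n := hM
      _ ≤ γ / (2 * k) * (2 * k * (n / k : ℕ)) := by gcongr; exact_mod_cast hn
      _ = γ * (n / k : ℕ) := by field_simp)
  rw [hspan] at h1
  zify [(by omega : 5 ≤ 4 * k)] at h1 hA'
  linarith

end Instances

/-! ### The theorem: choice of parameters -/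

theorem mainTheorem2 (k : ℕ) (P : (Fin k → ℤˣ) → Bool)
    (hP : ∃ μ : PMF (Fin k → ℤˣ), IsPairwiseIndependent μ ∧ ∀ y ∈ μ.support, P y = true)
    (ε : ℝ) (hε : 0 < ε) :
    ∃ δ : ℝ, 0 < δ ∧ ∃ N : ℕ, ∀ n : ℕ, N ≤ n →
      ∃ I : Finset (Clause k n), I.Nonempty ∧ (∀ C ∈ I, C.DistinctVars) ∧
        (∀ x : Fin n → ℤˣ,
          satFraction P I x ≤ (Fintype.card {y : Fin k → ℤˣ // P y = true} : ℝ) / 2 ^ k + ε) ∧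
        HasSOSValue P I ⌊δ * (n : ℝ)⌋₊ 1 := by
  obtain ⟨μ, hμ, hμP⟩ := hP
  -- For `k ≤ 2` the distribution is uniform, so `P` is identically true and a single clause
  -- suffices.
  rcases Nat.lt_or_ge k 3 with hk | hk
  · have hall := hμ.forall_eq_true (by omega) hμP
    refine ⟨1, one_pos, 2 * k, fun n hn => ?_⟩
    let C : Clause k n := fun i => (Fin.castLE (by omega) i, 1)
    refine ⟨{C}, Finset.singleton_nonempty C, fun D hD => ?_, fun x => ?_, ?_⟩
    · rw [Finset.mem_singleton.1 hD]
      exact Fin.castLE_injective (by omega : k ≤ n)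
    · have h1 : (Fintype.card {y : Fin k → ℤˣ // P y = true} : ℝ) / 2 ^ k = 1 := by
        rw [Fintype.card_subtype, Finset.filter_true_of_mem fun y _ => hall y, Finset.card_univ,
          card_signs]
        simp
      rw [h1]
      linarith [satFraction_le_one P {C} x]
    · rw [one_mul, Nat.floor_natCast]
      exact hasSOSValue_one_of_forall_eq_true hall (Finset.singleton_nonempty C) hn
  · have hk0 : (0 : ℝ) < k := by exact_mod_cast (by omega : 0 < k)
    set t : ℝ := min ε 1 / 2 with ht
    have ht0 : 0 < t := by positivity
    have htε : 2 * t ≤ ε := by linarith [min_le_left ε 1]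
    have ht1 : t ≤ 1 := by linarith [min_le_right ε 1]
    -- The number of clauses per variable: `t² c n ≥ n` lets the Chernoff bound beat the `2ⁿ`
    -- assignments.
    set c : ℕ := ⌈1 / t ^ 2⌉₊
    have hc0 : 0 < c := Nat.ceil_pos.2 (by positivity)
    have htc : 1 ≤ t ^ 2 * c := by
      have := Nat.le_ceil (1 / t ^ 2)
      rwa [div_le_iff₀' (by positivity)] at this
    obtain ⟨γ, hγ, hsparse⟩ := exists_sparse_hypergraph k c (by omega)
    -- Makes `12 k d ≤ γ n`, so that sparsity reaches the sets needed in degree `d`; the threshold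
    -- on `n` below ensures `2k ≤ d`.
    set δ : ℝ := γ / (12 * k) with hδ
    have hδ0 : 0 < δ := by positivity
    refine ⟨δ, hδ0, k + ⌈2 * k / δ⌉₊, fun n hn => ?_⟩
    set d : ℕ := ⌊δ * (n : ℝ)⌋₊
    have hd : 2 * k ≤ d := by
      refine Nat.le_floor ?_
      have h1 : (⌈2 * k / δ⌉₊ : ℝ) ≤ n := by exact_mod_cast (by omega : ⌈2 * k / δ⌉₊ ≤ n)
      have h2 := (Nat.le_ceil (2 * k / δ)).trans h1
      rw [div_le_iff₀' hδ0] at h2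
      exact_mod_cast h2
    obtain ⟨e, hinj, he⟩ := hsparse n (12 * k * d) (by omega) (by
      have h1 : (d : ℝ) ≤ δ * n := Nat.floor_le (by positivity)
      push_cast
      calc 12 * (k : ℝ) * d ≤ 12 * k * (δ * n) := by gcongr
        _ = γ * n := by rw [hδ]; field_simp)
    have hn0 : 0 < n := by omega
    have hm0 : 0 < c * n := Nat.mul_pos hc0 hn0
    obtain ⟨σ, hσ⟩ := exists_signs_sum_predValue_le P e ht0 ht1 htε hn0 (by
      push_cast
      rw [← mul_assoc]
      exact le_mul_of_one_le_left (Nat.cast_nonneg n) htc)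
    have hI : (Finset.univ.image (signedClause e σ)).Nonempty :=
      ⟨_, Finset.mem_image_of_mem _ (Finset.mem_univ ⟨0, hm0⟩)⟩
    refine ⟨Finset.univ.image (signedClause e σ), hI, fun C hC => ?_, fun x => ?_,
      hasSOSValue_one_of_sparse hμ hμP (by omega) he le_rfl hd σ hI⟩
    · obtain ⟨j, -, rfl⟩ := Finset.mem_image.1 hC
      exact hinj j
    · exact satFraction_image_signedClause_le hm0
        (he.signedClause_injective hk (by nlinarith) σ) (hσ x)
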